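/- Let $I=[0,1]$ or $I=[0,\infty)$ with Lebesgue measure $m$, and let $L^0(I)$ be the space of classes of a.e. equal real-valued measurable functions on $I$. A Banach function space $X$ on $I$ is a Banach space that is a linear subspace of $L^0(I)$, contains an a.e. positive function, and satisfies: if $|f|\le|g|$ a.e. and $g\in X$, then $f\in X$ and $\|f\|_X\le\|g\|_X$. It is symmetric if, whenever $f\in X$ and $g\in L^0(I)$ satisfy $m\{|f|>s\}=m\{|g|>s\}$ for all $s>0$, then $g\in X$ and $\|g\|_X=\|f\|_X$. Let $Cf(x)=\frac1x\int_0^x f(t)\,dt$ be the Cesàro operator and let $CX=\{f\in L^0(I): C|f|\in X\}$ with norm $\|f\|_{CX}=\|C|f|\|_X$. Write $Y\hookrightarrow Z$ for a continuous inclusion, and $Y=Z$ for equality of sets with equivalent norms; $Y\cap Z$ has the norm $\max\{\|f\|_Y,\|f\|_Z\}$. For a normed space $Y$ of functions on $I$ and $A\subset I$ put $Y|_A=\{f\in Y: f=0 \text{ a.e. outside } A\}$ with the norm of $Y$. For $Y$ on $[0,\infty)$ and $A\subset[0,1]$ the truncation is also regarded as a space of functions on $[0,1]$: $Y[0,\infty)|_A$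 consists of the $f\in L^0[0,1]$ that vanish a.e. outside $A$ and whose extension by zero to $[0,\infty)$ lies in $Y$, with the norm of that extension. In (2), (3) and (4) below, truncations of spaces on $[0,\infty)$ are understood in this second way, so that, for example, $C(X[0,\infty)|_{[0,1]})$ is the Cesàro space on $[0,1]$ built from $X[0,\infty)|_{[0,1]}$. Lemma. Let $X$ be a Banach function space on $I$ such that either $C$ is bounded on $X$, or $X$ is symmetric and, in case $I=[0,\infty)$, $CX\neq\{0\}$. (1) For every $0<\lambda<m(I)$, $$CX|_{[0,\lambda]}\hookrightarrow L^1(I)|_{[0,\lambda]}.$$ In general this fails for $\lambda=1$ if $I=[0,1]$ and for $\lambda=\infty$ if $I=[0,\infty)$: on each of the two intervals there is a space $X$ as above with $CX\not\hookrightarrow L^1(I)$. (2) If $I=[0,\infty)$, then $$CX[0,\infty)|_{[0,1]}=C\big(X[0,\infty)|_{[0,1]}\big)\cap L^1[0,1].$$ (3) If $I=[0,\infty)$ and $0<\lambda<1$, then $$CX[0,\infty)|_{[0,\lambda]}=\big(C(X[0,\infty)|_{[0,1]})\big)|_{[0,\lambda]}.$$ (4) Let $X$ be any symmetric space on $[0,\infty)$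 whose upper Boyd index $q(X)=\lim_{\tau\to0^+}\frac{\ln\tau}{\ln\|\sigma_\tau\|_{X\to X}}$, where $\sigma_\tau f(x)=f(x/\tau)$ (and the quotient is read as $\infty$ if $\|\sigma_\tau\|_{X\to X}=1$), is finite. Then $C(X[0,\infty)|_{[0,1]})\neq CX[0,\infty)|_{[0,1]}$, and $C(X[0,\infty)|_{[0,1]})$ is not contained in $CX[0,\infty)|_{[0,1]}$. -/

import Mathlib

open MeasureTheory Set Filter Topology
open scoped ENNReal

noncomputable section

/-- `L⁰(I)`: almost everywhere equivalence classes of real-valued measurable functions on `I`,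
with respect to Lebesgue measure. -/
abbrev L0 (I : Set ℝ) : Type := ℝ →ₘ[volume.restrict I] ℝ

/-- A space of (classes of) functions on `I`, given by its norm, extended by the value `∞` to the
functions of `L⁰(I)` that do not belong to the space. -/
abbrev ExtNorm (I : Set ℝ) : Type := L0 I → ℝ≥0∞

namespace ExtNorm

/-- Membership in the space. -/
def Mem {I : Set ℝ} (X : ExtNorm I) (f : L0 I) : Prop := X f < ∞

/-- The space contains a nonzero element. -/
def Nontrivial {I : Set ℝ} (X : ExtNorm I) : Prop := ∃ f : L0 I, X.Mem f ∧ f ≠ 0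

/-- Banach function spaces on `I` (with a weak unit). -/
structure IsBanachFunctionSpace {I : Set ℝ} (X : ExtNorm I) : Prop where
  add_le : ∀ f g : L0 I, X (f + g) ≤ X f + X g
  smul_eq : ∀ (c : ℝ) (f : L0 I), X (c • f) = ‖c‖ₑ * X f
  eq_zero : ∀ f : L0 I, X f = 0 → f = 0
  /-- The ideal property. -/
  ideal : ∀ f g : L0 I, (∀ᵐ t ∂(volume.restrict I), |f t| ≤ |g t|) → X f ≤ X g
  /-- Norm completeness. -/
  complete : ∀ f : ℕ → L0 I, (∀ n, X.Mem (f n)) →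
    (∀ ε : ℝ≥0∞, 0 < ε → ∃ N : ℕ, ∀ m ≥ N, ∀ n ≥ N, X (f m - f n) < ε) →
    ∃ g : L0 I, X.Mem g ∧ Tendsto (fun n => X (f n - g)) atTop (𝓝 0)
  /-- Existence of a weak unit. -/
  weak_unit : ∃ f₀ : L0 I, X.Mem f₀ ∧ ∀ᵐ t ∂(volume.restrict I), 0 < f₀ t

/-- Two functions are equimeasurable when they have the same distribution function. -/
def Equimeasurable {I : Set ℝ} (f g : L0 I) : Prop :=
  ∀ s : ℝ, 0 < s →
    (volume.restrict I) {t : ℝ | s < |f t|} = (volume.restrict I) {t : ℝ | s < |g t|}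

/-- Symmetric (rearrangement invariant) spaces. -/
structure IsSymmetric {I : Set ℝ} (X : ExtNorm I) : Prop extends X.IsBanachFunctionSpace where
  eq_of_equimeasurable : ∀ f g : L0 I, Equimeasurable f g → X f = X g

/-- The set inclusion `X ⊆ Y`. -/
def Subspace {I : Set ℝ} (X Y : ExtNorm I) : Prop := ∀ f : L0 I, X.Mem f → Y.Mem f

/-- The continuous embedding `X ↪ Y`. The displayed inequality also says that `f` is in `Y`. -/
def Embeds {I : Set ℝ} (X Y : ExtNorm I) : Prop :=
  ∃ M : ℝ, 0 < M ∧ ∀ f : L0 I, X.Mem f → Y f ≤ ENNReal.ofReal M * X f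

/-- `X = Y`: the same elements, with equivalent norms. -/
def SameSpace {I : Set ℝ} (X Y : ExtNorm I) : Prop := X.Embeds Y ∧ Y.Embeds X

/-- The intersection `X ∩ Y`, normed by the maximum of the two norms. -/
def inter {I : Set ℝ} (X Y : ExtNorm I) : ExtNorm I := fun f => max (X f) (Y f)

end ExtNorm

/-- The space `L¹(I)`. -/
def L1 (I : Set ℝ) : ExtNorm I := fun f => ∫⁻ t in I, ‖f t‖ₑ

/-- `C f` makes sense as an element of `L⁰(I)`: the integrals `∫_0^x f` converge absolutely for
almost every `x ∈ I`. -/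
def CesaroDefined {I : Set ℝ} (f : L0 I) : Prop :=
  ∀ᵐ x ∂(volume.restrict I), IntegrableOn f (Ioc 0 x) volume

theorem stronglyMeasurable_cesaro {I : Set ℝ} (f : L0 I) :
    StronglyMeasurable (fun x : ℝ => x⁻¹ * ∫ t in Ioc 0 x, f t) := by
  have h : StronglyMeasurable
      (Function.uncurry fun x t : ℝ => (Ioc 0 x).indicator (f : ℝ → ℝ) t) := by
    have hs : MeasurableSet {p : ℝ × ℝ | 0 < p.2 ∧ p.2 ≤ p.1} :=
      (measurableSet_lt measurable_const measurable_snd).inter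
        (measurableSet_le measurable_snd measurable_fst)
    exact (f.stronglyMeasurable.comp_measurable measurable_snd).indicator hs
  refine measurable_inv.stronglyMeasurable.mul ?_
  have h2 := h.integral_prod_right (ν := (volume : Measure ℝ))
  simpa only [Function.uncurry, integral_indicator measurableSet_Ioc] using h2

/-- The Cesàro operator `C f (x) = (1/x) ∫_0^x f(t) dt` (to be used when `CesaroDefined f`). -/
def cesaro {I : Set ℝ} (f : L0 I) : L0 I :=
  AEEqFun.mk (fun x : ℝ => x⁻¹ * ∫ t in Ioc 0 x, f t)
    (stronglyMeasurable_cesaro f).aestronglyMeasurable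

namespace ExtNorm

/-- The Cesàro operator is bounded on `X`. -/
def CesaroBounded {I : Set ℝ} (X : ExtNorm I) : Prop :=
  ∃ K : ℝ, 0 < K ∧ ∀ f : L0 I, X.Mem f →
    CesaroDefined f ∧ X (cesaro f) ≤ ENNReal.ofReal K * X f

open Classical in
/-- The abstract Cesàro space `CX = {f : C|f| ∈ X}` with the norm `‖f‖_{CX} = ‖C|f|‖_X`. -/
def ces {I : Set ℝ} (X : ExtNorm I) : ExtNorm I :=
  fun f => if CesaroDefined |f| then X (cesaro |f|) else ∞

end ExtNorm

/-- `supp f ⊆ A`, up to a null set. -/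
def SuppIn {I : Set ℝ} (f : L0 I) (A : Set ℝ) : Prop :=
  ∀ᵐ t ∂(volume.restrict I), f t ≠ 0 → t ∈ A

/-- Extension by zero of a function on `[0,1]` to `[0,∞)`. -/
def extendZero (f : L0 (Icc 0 1)) : L0 (Ici 0) :=
  AEEqFun.mk ((Icc (0 : ℝ) 1).indicator f)
    (f.stronglyMeasurable.indicator measurableSet_Icc).aestronglyMeasurable

namespace ExtNorm

open Classical in
/-- The truncation `X|_A = {f ∈ X : supp f ⊆ A}`, with the norm of `X`. -/
def trunc {I : Set ℝ} (X : ExtNorm I) (A : Set ℝ) : ExtNorm I :=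
  fun f => if SuppIn f A then X f else ∞

open Classical in
/-- The truncation `X[0,∞)|_A` of a space on `[0,∞)` to a set `A ⊆ [0,1]`, as a space of functions
on `[0,1]`: all functions `f` on `[0,1]` that vanish outside `A` and whose extension by zero
belongs to `X`, with the norm of that extension. -/
def truncUnit (X : ExtNorm (Ici 0)) (A : Set ℝ) : ExtNorm (Icc 0 1) :=
  fun f => if SuppIn f A then X (extendZero f) else ∞

end ExtNorm

/-- The dilation `σ_τ f (x) = f (x / τ)` on `[0,∞)`, for `τ > 0`. -/
def dilation (τ : ℝ) (f : L0 (Ici 0)) : L0 (Ici 0) :=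
  AEEqFun.mk (fun x : ℝ => f (x / τ))
    (f.stronglyMeasurable.comp_measurable (measurable_id.div_const τ)).aestronglyMeasurable

namespace ExtNorm

/-- The operator norm of `T` on `X`. -/
def opNorm {I : Set ℝ} (X : ExtNorm I) (T : L0 I → L0 I) : ℝ≥0∞ :=
  ⨆ (f : L0 I) (_ : X f ≤ 1), X (T f)

/-- `q` is the upper Boyd index `q(X) = lim_{τ → 0+} ln τ / ln ‖σ_τ‖` of a symmetric space `X`
on `[0,∞)`. For `τ < 1` one has `‖σ_τ‖ ≤ 1`, so that both logarithms are nonpositive; the signs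
are changed and the quotient is taken in `[0,∞]`, where it is `∞` if `‖σ_τ‖ = 1`. -/
def IsUpperBoydIndex (X : ExtNorm (Ici 0)) (q : ℝ≥0∞) : Prop :=
  Tendsto (fun τ : ℝ => ENNReal.ofReal (-Real.log τ) /
      ENNReal.ofReal (-Real.log (X.opNorm (dilation τ)).toReal))
    (𝓝[>] 0) (𝓝 q)

end ExtNorm

end

noncomputable section

/-! ### The Cesàro operator on positive functions -/

/-! Everything rests on how `C|f|` behaves to the right of the support of `f`. If `f` lives on
`[0,l]`, then `C|f|(x) = ‖f‖₁ / x` for `x ≥ l`. On an interval `[l,b]` inside `I` this gives `C|f| ≥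
b⁻¹ ‖f‖₁ χ_[l,b]`, and the ideal property turns it into the `L¹` bound (`IsSolid.exists_L1_le_ces`).

For `f` on `[0,1]` extended by zero, `C|f|` on the half-line is the Cesàro mean on `[0,1]` plus
`‖f‖₁ x⁻¹ χ_(1,∞)` (`coeFn_cesaro_extendZero`). So (2) reduces to (1) and to `x⁻¹ χ_(1,∞) ∈ X`
(`tailInv_one_lt_top`); the latter is where boundedness of `C`, or symmetry with `CX ≠ {0}`, enters.
For (3), estimate (1) on `[0,1]` makes the `L¹` part of the intersection redundant.

The endpoint cases of (1) fail in `L^∞` weighted by a decreasing `w`: `C` is a contraction there,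
while `1/w` lies in the space and need not be integrable.

For (4) take `f(t) = t/(1-t)`. It is not integrable, hence not in the truncation of `CX`, but `Cf(x)
≤ -log(1-x)`. A finite upper Boyd index gives `τ < 1` with `‖σ_τ‖ < 1`. The logarithm is at most
`-log τ` times `∑ χ_[1-τⁿ,1]`, and symmetry makes this series converge geometrically in `X`. -/

theorem abs_coeFn_restrict {I J : Set ℝ} (hJ : J ⊆ I) (f : L0 I) :
    ((|f| : L0 I) : ℝ → ℝ) =ᵐ[volume.restrict J] fun t => |f t| :=
  ae_restrict_of_ae_restrict_of_subset hJ (AEEqFun.coeFn_abs f)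

theorem cesaroDefined_abs_iff {I : Set ℝ} (hIm : MeasurableSet I) (hI : ∀ x ∈ I, Ioc 0 x ⊆ I)
    (f : L0 I) :
    CesaroDefined |f| ↔ ∀ᵐ x ∂(volume.restrict I), IntegrableOn f (Ioc 0 x) volume := by
  have key : ∀ x ∈ I, (IntegrableOn (|f| : L0 I) (Ioc 0 x) volume ↔
      IntegrableOn f (Ioc 0 x) volume) := fun x hx => by
    unfold IntegrableOn
    rw [integrable_congr (abs_coeFn_restrict (hI x hx) f)]
    exact integrable_norm_iff f.stronglyMeasurable.aestronglyMeasurable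
  refine eventually_congr ?_
  filter_upwards [ae_restrict_mem hIm] with x hx using key x hx

theorem coeFn_cesaro_abs {I : Set ℝ} (hIm : MeasurableSet I) (hI : ∀ x ∈ I, Ioc 0 x ⊆ I)
    (f : L0 I) :
    ∀ᵐ x ∂(volume.restrict I), cesaro |f| x = x⁻¹ * ∫ t in Ioc 0 x, |f t| := by
  filter_upwards [ae_restrict_mem hIm, AEEqFun.coeFn_mk (μ := volume.restrict I) _
    (stronglyMeasurable_cesaro |f|).aestronglyMeasurable] with x hx h
  rw [cesaro, h, integral_congr_ae (abs_coeFn_restrict (hI x hx) f)]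

theorem Ioc_zero_subset_Icc {b : ℝ} : ∀ x ∈ Icc (0 : ℝ) b, Ioc 0 x ⊆ Icc 0 b :=
  fun _ hx _ ht => ⟨ht.1.le, ht.2.trans hx.2⟩

theorem Ioc_zero_subset_Ici : ∀ x ∈ Ici (0 : ℝ), Ioc 0 x ⊆ Ici 0 :=
  fun _ _ _ ht => ht.1.le

/-- The class of the indicator function of `A`. -/
def indL0 (I : Set ℝ) {A : Set ℝ} (hA : MeasurableSet A) : L0 I :=
  AEEqFun.mk (A.indicator fun _ => (1 : ℝ))
    (stronglyMeasurable_const.indicator hA).aestronglyMeasurable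

theorem coeFn_indL0 (I : Set ℝ) {A : Set ℝ} (hA : MeasurableSet A) :
    (indL0 I hA : ℝ → ℝ) =ᵐ[volume.restrict I] A.indicator fun _ => (1 : ℝ) :=
  AEEqFun.coeFn_mk _ _

theorem indL0_ne_zero {I A : Set ℝ} (hA : MeasurableSet A) (h : volume.restrict I A ≠ 0) :
    indL0 I hA ≠ 0 := by
  intro h0
  have h1 := coeFn_indL0 I hA
  rw [h0] at h1
  refine h (measure_mono_null ?_
    (ae_iff.1 (h1.symm.trans (AEEqFun.coeFn_zero (μ := volume.restrict I) (β := ℝ)))))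
  intro x hx
  simp [hx]

namespace ExtNorm

theorem ces_lt_top {I : Set ℝ} {X : ExtNorm I} {f : L0 I} (h : X.ces f < ∞) :
    CesaroDefined |f| ∧ X.ces f = X (cesaro |f|) := by
  unfold ces at *
  split_ifs at * with hd
  · exact ⟨hd, rfl⟩
  · exact absurd h (lt_irrefl _)

theorem ces_eq {I : Set ℝ} {X : ExtNorm I} {f : L0 I} (h : CesaroDefined |f|) :
    X.ces f = X (cesaro |f|) := if_pos h

theorem trunc_lt_top {I : Set ℝ} {X : ExtNorm I} {A : Set ℝ} {f : L0 I} (h : X.trunc A f < ∞) :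
    SuppIn f A ∧ X.trunc A f = X f := by
  unfold trunc at *
  split_ifs at * with hd
  · exact ⟨hd, rfl⟩
  · exact absurd h (lt_irrefl _)

theorem truncUnit_lt_top {X : ExtNorm (Ici 0)} {A : Set ℝ} {f : L0 (Icc 0 1)}
    (h : X.truncUnit A f < ∞) : SuppIn f A ∧ X.truncUnit A f = X (extendZero f) := by
  unfold truncUnit at *
  split_ifs at * with hd
  · exact ⟨hd, rfl⟩
  · exact absurd h (lt_irrefl _)

/-- The part of the axioms of a Banach function space that does not involve sums and limits. -/
structure IsSolid {I : Set ℝ} (X : ExtNorm I) : Prop where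
  smul_eq : ∀ (c : ℝ) (f : L0 I), X (c • f) = ‖c‖ₑ * X f
  eq_zero : ∀ f : L0 I, X f = 0 → f = 0
  ideal : ∀ f g : L0 I, (∀ᵐ t ∂(volume.restrict I), |f t| ≤ |g t|) → X f ≤ X g

theorem IsBanachFunctionSpace.isSolid {I : Set ℝ} {X : ExtNorm I}
    (hX : X.IsBanachFunctionSpace) : X.IsSolid :=
  ⟨hX.smul_eq, hX.eq_zero, hX.ideal⟩

theorem IsSolid.mul_le {I : Set ℝ} {X : ExtNorm I} (hX : X.IsSolid) {c : ℝ} (hc : 0 ≤ c)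
    {f g : L0 I} (h : ∀ᵐ t ∂(volume.restrict I), c * |f t| ≤ |g t|) :
    ENNReal.ofReal c * X f ≤ X g := by
  have h1 := hX.smul_eq c f
  rw [Real.enorm_eq_ofReal hc] at h1
  rw [← h1]
  refine hX.ideal _ _ ?_
  filter_upwards [h, AEEqFun.coeFn_smul c f] with t ht hs
  rw [hs, Pi.smul_apply, smul_eq_mul, abs_mul, abs_of_nonneg hc]
  exact ht

theorem IsSolid.lt_top_of_mul_le {I : Set ℝ} {X : ExtNorm I} (hX : X.IsSolid) {c : ℝ} (hc : 0 < c)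
    {f g : L0 I} (h : ∀ᵐ t ∂(volume.restrict I), c * |f t| ≤ |g t|) (hg : X g < ∞) : X f < ∞ := by
  have h1 := (hX.mul_le hc.le h).trans_lt hg
  by_contra h2
  rw [not_lt, top_le_iff] at h2
  rw [h2, ENNReal.mul_top (by simpa using hc)] at h1
  exact lt_irrefl _ h1

end ExtNorm

/-- Once `x` has passed `l`, the interval `(0,x]` catches all of the mass of `f`; only the null set
`{0}` is lost. -/
theorem SuppIn.L1_eq_ofReal_integral {I : Set ℝ} (hIm : MeasurableSet I)
    (hI : ∀ x ∈ I, Ioc 0 x ⊆ I) {f : L0 I} {l : ℝ} (hs : SuppIn f (Icc 0 l)) {x : ℝ}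
    (hx : x ∈ I) (hlx : l ≤ x) (hf : IntegrableOn f (Ioc 0 x)) :
    L1 I f = ENNReal.ofReal (∫ t in Ioc 0 x, |f t|) := by
  have h1 := ofReal_integral_norm_eq_lintegral_enorm hf
  simp only [Real.norm_eq_abs] at h1
  rw [h1, L1, ← lintegral_indicator hIm, ← lintegral_indicator measurableSet_Ioc]
  refine lintegral_congr_ae ?_
  have h0 : ∀ᵐ t : ℝ, t ≠ 0 := by simp [ae_iff]
  filter_upwards [h0, (ae_restrict_iff' hIm).1 hs] with t ht0 ht
  by_cases h : t ∈ I
  · rw [indicator_of_mem h]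
    by_cases h2 : t ∈ Ioc 0 x
    · rw [indicator_of_mem h2]
    · rw [indicator_of_notMem h2]
      by_contra h3
      have h4 := ht h (by simpa using h3)
      exact h2 ⟨lt_of_le_of_ne h4.1 ht0.symm, h4.2.trans hlx⟩
  · rw [indicator_of_notMem h, indicator_of_notMem]
    exact fun h2 => h (hI x hx h2)

/-- On functions supported in `[0, l]` the norm of the Cesàro space dominates the `L¹` norm. -/
theorem ExtNorm.IsSolid.exists_L1_le_ces {I : Set ℝ} (hIm : MeasurableSet I)
    (hI : ∀ x ∈ I, Ioc 0 x ⊆ I) {X : ExtNorm I} (hX : X.IsSolid) {l b : ℝ} (hl : 0 < l)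
    (hlb : l < b) (hb : Icc l b ⊆ I) :
    ∃ M : ℝ, 0 < M ∧ ∀ f : L0 I, SuppIn f (Icc 0 l) → X.ces f < ∞ →
      L1 I f ≤ ENNReal.ofReal M * X.ces f := by
  have hJ : volume.restrict I (Icc l b) ≠ 0 := by
    rw [Measure.restrict_apply measurableSet_Icc, inter_eq_left.2 hb, Real.volume_Icc]
    simpa using hlb
  have hb0 : 0 < b := hl.trans hlb
  set k := X (indL0 I (measurableSet_Icc (a := l) (b := b))) with hk
  have hk0 : k ≠ 0 := fun h => indL0_ne_zero measurableSet_Icc hJ (hX.eq_zero _ h)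
  have main : ∀ f : L0 I, SuppIn f (Icc 0 l) → X.ces f < ∞ → ∃ c : ℝ, 0 ≤ c ∧
      L1 I f = ENNReal.ofReal c ∧ ENNReal.ofReal (b⁻¹ * c) * k ≤ X.ces f := by
    intro f hs hf
    obtain ⟨hd, he⟩ := ces_lt_top hf
    rw [cesaroDefined_abs_iff hIm hI] at hd
    have hd' : ∀ᵐ x ∂(volume.restrict (Icc l b)), IntegrableOn f (Ioc 0 x) :=
      ae_restrict_of_ae_restrict_of_subset hb hd
    have hne : (ae (volume.restrict (Icc l b))).NeBot := by
      rw [ae_neBot, Ne, Measure.restrict_eq_zero, Real.volume_Icc]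
      simpa using hlb
    -- The integrals are known to converge only for almost every `x`, so one good point of `[l,b]`
    -- is chosen to define `c = ‖f‖₁`.
    obtain ⟨y, hyi, hy⟩ := (hd'.and (ae_restrict_mem measurableSet_Icc)).exists
    refine ⟨∫ t in Ioc 0 y, |f t|, integral_nonneg fun _ => abs_nonneg _,
      hs.L1_eq_ofReal_integral hIm hI (hb hy) hy.1 hyi, ?_⟩
    rw [he]
    refine hX.mul_le (mul_nonneg (inv_nonneg.2 hb0.le) (integral_nonneg fun _ => abs_nonneg _)) ?_
    filter_upwards [hd, coeFn_cesaro_abs hIm hI f, coeFn_indL0 I (measurableSet_Icc (a := l) (b := b)),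
      ae_restrict_mem hIm] with x hxi hxc hx1 hx
    rw [hx1, hxc]
    by_cases hxl : x ∈ Icc l b
    · have h1 := hs.L1_eq_ofReal_integral hIm hI (hb hy) hy.1 hyi
      rw [hs.L1_eq_ofReal_integral hIm hI hx hxl.1 hxi, ENNReal.ofReal_eq_ofReal_iff
        (integral_nonneg fun _ => abs_nonneg _) (integral_nonneg fun _ => abs_nonneg _)] at h1
      have hx0 : 0 < x := hl.trans_le hxl.1
      have h2 : 0 ≤ ∫ t in Ioc 0 y, |f t| := integral_nonneg fun _ => abs_nonneg _
      rw [h1, indicator_of_mem hxl, abs_one, mul_one,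
        abs_of_nonneg (mul_nonneg (inv_nonneg.2 hx0.le) h2)]
      exact mul_le_mul_of_nonneg_right (inv_anti₀ hx0 hxl.2) h2
    · rw [indicator_of_notMem hxl, abs_zero, mul_zero]
      exact abs_nonneg _
  -- Nothing places `χ_[l,b]` in `X`. If its norm is infinite, the lower bound forces `c = 0` and
  -- any constant will do.
  by_cases hkt : k = ∞
  · refine ⟨1, one_pos, fun f hs hf => ?_⟩
    obtain ⟨c, hc, h1, h2⟩ := main f hs hf
    rw [h1]
    rcases hc.eq_or_lt with rfl | hc
    · simp
    · rw [hkt, ENNReal.mul_top (by simpa using mul_pos (inv_pos.2 hb0) hc), top_le_iff] at h2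
      exact absurd h2 hf.ne
  · have hk1 : 0 < k.toReal := ENNReal.toReal_pos hk0 hkt
    refine ⟨b / k.toReal, div_pos hb0 hk1, fun f hs hf => ?_⟩
    obtain ⟨c, hc, h1, h2⟩ := main f hs hf
    rw [h1]
    calc ENNReal.ofReal c = ENNReal.ofReal (b / k.toReal) *
          (ENNReal.ofReal (b⁻¹ * c) * ENNReal.ofReal k.toReal) := by
          rw [← ENNReal.ofReal_mul (by positivity), ← ENNReal.ofReal_mul (by positivity)]
          congr 1
          field_simp
      _ = ENNReal.ofReal (b / k.toReal) * (ENNReal.ofReal (b⁻¹ * c) * k) := by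
          rw [ENNReal.ofReal_toReal hkt]
      _ ≤ _ := by gcongr

theorem ExtNorm.IsSolid.ces_trunc_embeds_L1 {I : Set ℝ} (hIm : MeasurableSet I)
    (hI : ∀ x ∈ I, Ioc 0 x ⊆ I) {X : ExtNorm I} (hX : X.IsSolid) {l b : ℝ} (hl : 0 < l)
    (hlb : l < b) (hb : Icc l b ⊆ I) :
    (X.ces.trunc (Icc 0 l)).Embeds ((L1 I).trunc (Icc 0 l)) := by
  obtain ⟨M, hM, h⟩ := hX.exists_L1_le_ces hIm hI hl hlb hb
  refine ⟨M, hM, fun f hf => ?_⟩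
  obtain ⟨hs, he⟩ := trunc_lt_top hf
  rw [he, trunc, if_pos hs]
  exact h f hs (he ▸ hf)

/-! ### Symmetric spaces contain the indicator functions of bounded sets -/

namespace ExtNorm

theorem IsBanachFunctionSpace.le_add {I : Set ℝ} {X : ExtNorm I} (hX : X.IsBanachFunctionSpace)
    {f g h : L0 I} (H : ∀ᵐ t ∂(volume.restrict I), |f t| ≤ |g t + h t|) : X f ≤ X g + X h := by
  refine (hX.ideal f (g + h) ?_).trans (hX.add_le g h)
  filter_upwards [H, AEEqFun.coeFn_add g h] with t ht h1
  rwa [h1]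

theorem equimeasurable_indL0 {I A B : Set ℝ} (hA : MeasurableSet A) (hB : MeasurableSet B)
    (h : volume.restrict I A = volume.restrict I B) :
    Equimeasurable (indL0 I hA) (indL0 I hB) := by
  have key : ∀ (D : Set ℝ) (hD : MeasurableSet D) (s : ℝ), 0 < s →
      volume.restrict I {t : ℝ | s < |indL0 I hD t|} =
        if s < 1 then volume.restrict I D else 0 := by
    intro D hD s hs
    have h1 : {t : ℝ | s < |indL0 I hD t|} =ᵐ[volume.restrict I]
        {t : ℝ | s < |D.indicator (fun _ => (1 : ℝ)) t|} := by
      filter_upwards [coeFn_indL0 I hD] with t ht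
      change (s < |indL0 I hD t|) = (s < |D.indicator (fun _ => (1 : ℝ)) t|)
      rw [ht]
    rw [measure_congr h1]
    split_ifs with h2
    · congr 1
      ext t
      by_cases h3 : t ∈ D <;> simp [h3, h2, hs.le]
    · refine measure_mono_null (fun t ht => ?_) measure_empty
      by_cases h3 : t ∈ D
      · exact h2 (by simpa [h3] using ht)
      · exact lt_asymm hs (by simpa [h3] using ht)
  intro s hs
  rw [key A hA s hs, key B hB s hs, h]

theorem IsSolid.indL0_mono {I : Set ℝ} {X : ExtNorm I} (hX : X.IsSolid) {A B : Set ℝ}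
    (hA : MeasurableSet A) (hB : MeasurableSet B) (h : A ⊆ B) :
    X (indL0 I hA) ≤ X (indL0 I hB) := by
  refine hX.ideal _ _ ?_
  filter_upwards [coeFn_indL0 I hA, coeFn_indL0 I hB] with t h1 h2
  rw [h1, h2]
  by_cases h3 : t ∈ A
  · simp [h3, h h3]
  · simp [h3]

/-- A weak unit exceeds some `s > 0` on a set of finite positive measure `δ`. The indicator of that
set is therefore in `X`, by symmetry so is that of every interval of length `δ`, and finitely many
of these cover `[0,b]`. -/
theorem IsSymmetric.indL0_Icc_lt_top {X : ExtNorm (Ici 0)} (hX : X.IsSymmetric) (b : ℝ) :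
    X (indL0 (Ici 0) (measurableSet_Icc (a := (0 : ℝ)) (b := b))) < ∞ := by
  have hS := hX.toIsBanachFunctionSpace.isSolid
  obtain ⟨f, hf, hpos⟩ := hX.weak_unit
  obtain ⟨n, hn⟩ : ∃ n : ℕ, volume.restrict (Ici 0) {t : ℝ | 1 / ((n : ℝ) + 1) < f t} ≠ 0 := by
    by_contra! hcon
    have h1 : ∀ᵐ t ∂(volume.restrict (Ici (0 : ℝ))), ∀ n : ℕ, ¬ (1 / ((n : ℝ) + 1) < f t) :=
      ae_all_iff.2 fun n => by
        rw [ae_iff]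
        simpa only [not_not] using hcon n
    have hne : (ae (volume.restrict (Ici (0 : ℝ)))).NeBot := by
      rw [ae_neBot, Ne, Measure.restrict_eq_zero]
      simp
    obtain ⟨t, h2, h3⟩ := (h1.and hpos).exists
    obtain ⟨n, hn⟩ := exists_nat_one_div_lt h3
    exact h2 n hn
  set s : ℝ := 1 / ((n : ℝ) + 1) with hs
  have hs0 : 0 < s := by positivity
  have hmeas : MeasurableSet {t : ℝ | s < f t} :=
    measurableSet_lt measurable_const f.stronglyMeasurable.measurable
  obtain ⟨E, hEm, hEs, hE0, hEt⟩ :=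
    Measure.exists_subset_measure_lt_top (μ := volume.restrict (Ici (0 : ℝ))) hmeas
      (pos_iff_ne_zero.2 hn)
  set δ := (volume.restrict (Ici (0 : ℝ)) E).toReal with hδ
  have hδ0 : 0 < δ := ENNReal.toReal_pos hE0.ne' hEt.ne
  have hEX : X (indL0 (Ici 0) hEm) < ∞ := by
    refine hS.lt_top_of_mul_le (g := f) hs0 ?_ hf
    filter_upwards [coeFn_indL0 (Ici 0) hEm] with t ht
    rw [ht]
    by_cases h : t ∈ E
    · have h1 : s < f t := hEs h
      simpa [h] using h1.le.trans (le_abs_self _)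
    · simp [h]
  have hshift : ∀ a : ℝ, 0 ≤ a →
      X (indL0 (Ici 0) (measurableSet_Icc (a := a) (b := a + δ))) < ∞ := by
    intro a ha
    rwa [hX.eq_of_equimeasurable _ _ (equimeasurable_indL0 measurableSet_Icc hEm ?_)]
    have hsub : Icc a (a + δ) ⊆ Ici 0 := fun t ht => ha.trans ht.1
    rw [Measure.restrict_apply measurableSet_Icc, inter_eq_left.2 hsub,
      Real.volume_Icc, add_sub_cancel_left, ENNReal.ofReal_toReal hEt.ne]
  have hmult : ∀ k : ℕ,
      X (indL0 (Ici 0) (measurableSet_Icc (a := (0 : ℝ)) (b := (k + 1) * δ))) < ∞ := by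
    intro k
    induction k with
    | zero => simpa using hshift 0 le_rfl
    | succ k ih =>
      have hk : (0 : ℝ) ≤ (k + 1) * δ := by positivity
      refine (hX.le_add ?_).trans_lt (ENNReal.add_lt_top.2 ⟨ih, hshift ((k + 1) * δ) hk⟩)
      filter_upwards [coeFn_indL0 (Ici 0) (measurableSet_Icc (a := (0 : ℝ)) (b := (k + 1) * δ)),
        coeFn_indL0 (Ici 0) (measurableSet_Icc (a := (k + 1) * δ) (b := (k + 1) * δ + δ)),
        coeFn_indL0 (Ici 0) (measurableSet_Icc (a := (0 : ℝ)) (b := ((k + 1 : ℕ) + 1) * δ))]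
        with t h1 h2 h3
      rw [h1, h2, h3]
      push_cast
      have h0 : ∀ A : Set ℝ, 0 ≤ A.indicator (fun _ => (1 : ℝ)) t :=
        fun A => indicator_nonneg (fun _ _ => zero_le_one) t
      rw [abs_of_nonneg (h0 _), abs_of_nonneg (add_nonneg (h0 _) (h0 _))]
      by_cases h4 : t ∈ Icc (0 : ℝ) ((k + 1 + 1) * δ)
      · rw [indicator_of_mem h4]
        rcases le_total t ((k + 1) * δ) with h5 | h5
        · rw [indicator_of_mem (show t ∈ Icc (0 : ℝ) ((k + 1) * δ) from ⟨h4.1, h5⟩)]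
          exact le_add_of_nonneg_right (h0 _)
        · rw [indicator_of_mem (show t ∈ Icc ((k + 1) * δ) ((k + 1) * δ + δ) from
            ⟨h5, h4.2.trans (by linarith)⟩)]
          exact le_add_of_nonneg_left (h0 _)
      · rw [indicator_of_notMem h4]
        exact add_nonneg (h0 _) (h0 _)
  obtain ⟨k, hk⟩ := exists_nat_ge (b / δ)
  refine (hS.indL0_mono measurableSet_Icc measurableSet_Icc
    (Icc_subset_Icc_right ?_)).trans_lt (hmult k)
  rw [div_le_iff₀ hδ0] at hk
  nlinarith

end ExtNorm

/-! ### The function `1/x` near infinity -/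

/-- The class of the function `x⁻¹` on `(b, ∞)`, extended by zero. -/
def tailInv (b : ℝ) : L0 (Ici 0) :=
  AEEqFun.mk ((Ioi b).indicator fun x => x⁻¹)
    (measurable_inv.stronglyMeasurable.indicator measurableSet_Ioi).aestronglyMeasurable

theorem coeFn_tailInv (b : ℝ) :
    (tailInv b : ℝ → ℝ) =ᵐ[volume.restrict (Ici 0)] (Ioi b).indicator fun x => x⁻¹ :=
  AEEqFun.coeFn_mk _ _

namespace ExtNorm

/-- For `x > b` one has `x · C|f|(x) ≥ ∫_0^b |f| > 0`, so the tail of `1/x` is dominated by a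
multiple of `C|f|`. -/
theorem IsSolid.tailInv_lt_top {X : ExtNorm (Ici 0)} (hX : X.IsSolid) {f : L0 (Ici 0)}
    (hf : X.ces f < ∞) {b : ℝ} (hb : 0 < b)
    (hfb : ¬ (f : ℝ → ℝ) =ᵐ[volume.restrict (Ioc 0 b)] 0) : X (tailInv b) < ∞ := by
  obtain ⟨hd, he⟩ := ces_lt_top hf
  rw [cesaroDefined_abs_iff measurableSet_Ici Ioc_zero_subset_Ici] at hd
  have hd' : ∀ᵐ x ∂(volume.restrict (Ioi b)), IntegrableOn f (Ioc 0 x) :=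
    ae_restrict_of_ae_restrict_of_subset (fun t ht => hb.le.trans (le_of_lt ht)) hd
  have hne : (ae (volume.restrict (Ioi b))).NeBot := by
    rw [ae_neBot, Ne, Measure.restrict_eq_zero]
    simp
  obtain ⟨y, hyi, hy⟩ := (hd'.and (ae_restrict_mem measurableSet_Ioi)).exists
  have hfi : IntegrableOn (fun t => |f t|) (Ioc 0 b) :=
    (hyi.mono_set (Ioc_subset_Ioc_right (le_of_lt hy))).abs
  have hc0 : 0 ≤ ∫ t in Ioc 0 b, |f t| := integral_nonneg fun _ => abs_nonneg _
  have hc : 0 < ∫ t in Ioc 0 b, |f t| := by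
    refine lt_of_le_of_ne hc0 fun h => hfb ?_
    have h1 := (integral_eq_zero_iff_of_nonneg (fun _ => abs_nonneg _) hfi).1 h.symm
    filter_upwards [h1] with t ht
    simpa using ht
  rw [he] at hf
  refine hX.lt_top_of_mul_le hc ?_ hf
  filter_upwards [hd, coeFn_cesaro_abs measurableSet_Ici Ioc_zero_subset_Ici f, coeFn_tailInv b]
    with x hxi hxc hxt
  rw [hxt, hxc]
  by_cases hx : x ∈ Ioi b
  · have hx0 : 0 < x := hb.trans hx
    have h2 : ∫ t in Ioc 0 b, |f t| ≤ ∫ t in Ioc 0 x, |f t| :=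
      setIntegral_mono_set hxi.abs (ae_of_all _ fun _ => abs_nonneg _)
        (Ioc_subset_Ioc_right (le_of_lt hx)).eventuallyLE
    rw [indicator_of_mem hx, abs_mul, abs_of_pos (inv_pos.2 hx0), abs_of_nonneg (hc0.trans h2),
      mul_comm]
    exact mul_le_mul_of_nonneg_left h2 (inv_pos.2 hx0).le
  · rw [indicator_of_notMem hx, abs_zero, mul_zero]
    exact abs_nonneg _

/-- If `C` is bounded, a weak unit already has mass on `(0,1]`. In the symmetric case an element of
`CX` may vanish there, so the tail is obtained only beyond some larger `b`, and `χ_[0,b] ∈ X` fills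
the gap `(1,b]`. -/
theorem tailInv_one_lt_top {X : ExtNorm (Ici 0)} (hX : X.IsBanachFunctionSpace)
    (h : X.CesaroBounded ∨ (X.IsSymmetric ∧ X.ces.Nontrivial)) : X (tailInv 1) < ∞ := by
  rcases h with ⟨K, -, hK⟩ | ⟨hsym, f, hf, hf0⟩
  · obtain ⟨f, hf, hpos⟩ := hX.weak_unit
    have habs : X |f| ≤ X f := by
      refine hX.ideal _ _ ?_
      filter_upwards [AEEqFun.coeFn_abs f] with t ht
      rw [ht, abs_abs]
    have hf' : X.Mem |f| := habs.trans_lt hf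
    obtain ⟨hd, hle⟩ := hK |f| hf'
    refine hX.isSolid.tailInv_lt_top (f := f) ?_ one_pos ?_
    · rw [ces_eq hd]
      exact hle.trans_lt (ENNReal.mul_lt_top ENNReal.ofReal_lt_top hf')
    · intro h0
      have h1 : ∀ᵐ t ∂(volume.restrict (Ioc (0 : ℝ) 1)), 0 < f t :=
        ae_restrict_of_ae_restrict_of_subset (fun t ht => ht.1.le) hpos
      have hne : (ae (volume.restrict (Ioc (0 : ℝ) 1))).NeBot := by
        rw [ae_neBot, Ne, Measure.restrict_eq_zero]
        simp
      obtain ⟨t, h2, h3⟩ := (h1.and h0).exists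
      rw [h3] at h2
      exact lt_irrefl _ h2
  · obtain ⟨n, hn⟩ : ∃ n : ℕ, ¬ (f : ℝ → ℝ) =ᵐ[volume.restrict (Ioc 0 ((n : ℝ) + 1))] 0 := by
      by_contra! hcon
      refine hf0 (AEEqFun.ext ?_)
      refine EventuallyEq.trans ?_
        (AEEqFun.coeFn_zero (μ := volume.restrict (Ici (0 : ℝ))) (β := ℝ)).symm
      have hU : (⋃ n : ℕ, Ioc (0 : ℝ) ((n : ℝ) + 1)) = Ioi 0 := by
        ext t
        simp only [mem_iUnion, mem_Ioc, mem_Ioi]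
        refine ⟨fun ⟨n, h⟩ => h.1, fun h => ?_⟩
        obtain ⟨n, hn⟩ := exists_nat_ge t
        exact ⟨n, h, by linarith⟩
      have hfin : ∀ᵐ t ∂(volume.restrict (Ioi (0 : ℝ))), f t = 0 := by
        rw [← hU]
        exact (ae_restrict_iUnion_iff _ _).2 hcon
      rwa [restrict_Ioi_eq_restrict_Ici] at hfin
    set b : ℝ := (n : ℝ) + 1 with hb
    have hb1 : 1 ≤ b := by rw [hb]; linarith [n.cast_nonneg (α := ℝ)]
    refine (hX.le_add ?_).trans_lt (ENNReal.add_lt_top.2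
      ⟨hX.isSolid.tailInv_lt_top hf (by linarith) hn, hsym.indL0_Icc_lt_top b⟩)
    filter_upwards [coeFn_tailInv 1, coeFn_tailInv b,
      coeFn_indL0 (Ici 0) (measurableSet_Icc (a := (0 : ℝ)) (b := b))] with x h1 h2 h3
    rw [h1, h2, h3]
    by_cases hx1 : x ∈ Ioi 1
    · have hx1' : 1 < x := hx1
      have hx0 : 0 < x := by linarith
      rw [indicator_of_mem hx1]
      by_cases hxb : x ∈ Ioi b
      · have : x ∉ Icc 0 b := fun h => absurd h.2 (not_le.2 hxb)
        rw [indicator_of_mem hxb, indicator_of_notMem this, add_zero]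
      · rw [indicator_of_notMem hxb, indicator_of_mem (show x ∈ Icc 0 b from
          ⟨hx0.le, not_lt.1 hxb⟩), zero_add, abs_one, abs_of_pos (inv_pos.2 hx0)]
        exact inv_le_one_of_one_le₀ hx1'.le
    · rw [indicator_of_notMem hx1, abs_zero]
      exact abs_nonneg _

end ExtNorm

/-! ### Extension by zero -/

theorem coeFn_extendZero (f : L0 (Icc 0 1)) :
    (extendZero f : ℝ → ℝ) =ᵐ[volume.restrict (Ici 0)] (Icc (0 : ℝ) 1).indicator f :=
  AEEqFun.coeFn_mk _ _

theorem coeFn_extendZero_restrict (f : L0 (Icc 0 1)) :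
    (extendZero f : ℝ → ℝ) =ᵐ[volume.restrict (Icc 0 1)] f := by
  filter_upwards [ae_restrict_of_ae_restrict_of_subset (fun t ht => ht.1) (coeFn_extendZero f),
    ae_restrict_mem measurableSet_Icc] with t h1 h2
  rw [h1, indicator_of_mem h2]

theorem ae_Ici_of_ae_Icc {p : ℝ → Prop} (h : ∀ᵐ t ∂(volume.restrict (Icc (0 : ℝ) 1)), p t) :
    ∀ᵐ t ∂(volume.restrict (Ici (0 : ℝ))), t ∈ Icc (0 : ℝ) 1 → p t :=
  ae_restrict_of_ae ((ae_restrict_iff' measurableSet_Icc).1 h)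

theorem suppIn_extendZero (f : L0 (Icc 0 1)) : SuppIn (extendZero f) (Icc 0 1) := by
  filter_upwards [coeFn_extendZero f] with t ht h0
  by_contra h
  exact h0 (by rw [ht, indicator_of_notMem h])

theorem suppIn_Icc (f : L0 (Icc 0 1)) : SuppIn f (Icc 0 1) := by
  filter_upwards [ae_restrict_mem measurableSet_Icc] with t ht _ using ht

theorem L1_extendZero (f : L0 (Icc 0 1)) : L1 (Ici 0) (extendZero f) = L1 (Icc 0 1) f := by
  unfold L1
  rw [lintegral_congr_ae (g := (Icc (0 : ℝ) 1).indicator fun t => ‖f t‖ₑ),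
    lintegral_indicator measurableSet_Icc, Measure.restrict_restrict measurableSet_Icc,
    inter_eq_left.2 fun t ht => ht.1]
  filter_upwards [coeFn_extendZero f] with t ht
  rw [ht, enorm_indicator_eq_indicator_enorm]

theorem extendZero_Ioc {f : L0 (Icc 0 1)} {x : ℝ} (hx : x ∈ Icc (0 : ℝ) 1) :
    (extendZero f : ℝ → ℝ) =ᵐ[volume.restrict (Ioc 0 x)] f :=
  ae_restrict_of_ae_restrict_of_subset (Ioc_zero_subset_Icc x hx) (coeFn_extendZero_restrict f)

theorem cesaroDefined_of_extendZero {f : L0 (Icc 0 1)} (h : CesaroDefined |extendZero f|) :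
    CesaroDefined |f| := by
  rw [cesaroDefined_abs_iff measurableSet_Ici Ioc_zero_subset_Ici] at h
  rw [cesaroDefined_abs_iff measurableSet_Icc Ioc_zero_subset_Icc]
  filter_upwards [ae_restrict_of_ae_restrict_of_subset (fun t ht => ht.1) h,
    ae_restrict_mem measurableSet_Icc] with x h1 h2
  exact h1.congr_fun_ae (extendZero_Ioc h2)

theorem cesaroDefined_extendZero {f : L0 (Icc 0 1)} (h : L1 (Icc 0 1) f < ∞) :
    CesaroDefined |extendZero f| := by
  rw [cesaroDefined_abs_iff measurableSet_Ici Ioc_zero_subset_Ici]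
  have h1 : IntegrableOn (extendZero f) (Ici 0) :=
    ⟨(extendZero f).aestronglyMeasurable, by rwa [← L1_extendZero] at h⟩
  filter_upwards [ae_restrict_mem measurableSet_Ici] with x hx
  exact h1.mono_set (Ioc_zero_subset_Ici x hx)

/-- Beyond `1` the integral stays equal to `‖f‖₁`. Convergence at some `x > 1`, part of the
hypothesis, makes this number finite, so `toReal` loses nothing. -/
theorem coeFn_cesaro_extendZero {f : L0 (Icc 0 1)} (h : CesaroDefined |extendZero f|) :
    (cesaro |extendZero f| : ℝ → ℝ) =ᵐ[volume.restrict (Ici 0)] fun x =>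
      extendZero (cesaro |f|) x + (L1 (Icc 0 1) f).toReal * tailInv 1 x := by
  filter_upwards [coeFn_cesaro_abs measurableSet_Ici Ioc_zero_subset_Ici (extendZero f),
    coeFn_extendZero (cesaro |f|), coeFn_tailInv 1,
    ae_Ici_of_ae_Icc (coeFn_cesaro_abs measurableSet_Icc Ioc_zero_subset_Icc f),
    (cesaroDefined_abs_iff measurableSet_Ici Ioc_zero_subset_Ici _).1 h,
    ae_restrict_mem measurableSet_Ici] with x h1 h2 h3 h4 h5 hx
  rw [h1, h2, h3]
  by_cases hx1 : x ∈ Icc (0 : ℝ) 1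
  · have h6 : (fun t => |extendZero f t|) =ᵐ[volume.restrict (Ioc 0 x)] fun t => |f t| := by
      filter_upwards [extendZero_Ioc hx1] with t ht
      rw [ht]
    rw [indicator_of_mem hx1, indicator_of_notMem (notMem_Ioi.2 hx1.2),
      h4 hx1, integral_congr_ae h6, mul_zero, add_zero]
  · have hx2 : 1 < x := by
      by_contra h
      exact hx1 ⟨hx, not_lt.1 h⟩
    rw [indicator_of_notMem hx1, indicator_of_mem (show x ∈ Ioi 1 from hx2), ← L1_extendZero,
      (suppIn_extendZero f).L1_eq_ofReal_integral measurableSet_Ici Ioc_zero_subset_Ici hx hx2.le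
        h5, ENNReal.toReal_ofReal (integral_nonneg fun _ => abs_nonneg _), zero_add, mul_comm]

/-! ### Comparing the Cesàro space of a truncation with the truncation of a Cesàro space -/

namespace ExtNorm

theorem truncUnit_Icc (X : ExtNorm (Ici 0)) (f : L0 (Icc 0 1)) :
    X.truncUnit (Icc 0 1) f = X (extendZero f) := if_pos (suppIn_Icc f)

/-- Allows the `L¹` estimate to be applied to the truncated space on `[0,1]` as well. -/
theorem IsSolid.truncUnit {X : ExtNorm (Ici 0)} (hX : X.IsSolid) :
    (X.truncUnit (Icc 0 1)).IsSolid where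
  smul_eq c f := by
    rw [truncUnit_Icc, truncUnit_Icc, ← hX.smul_eq]
    congr 1
    refine AEEqFun.ext ?_
    filter_upwards [coeFn_extendZero (c • f), coeFn_extendZero f,
      AEEqFun.coeFn_smul c (extendZero f), ae_Ici_of_ae_Icc (AEEqFun.coeFn_smul c f)]
      with t h1 h2 h3 h4
    rw [h1, h3, Pi.smul_apply, h2]
    by_cases h : t ∈ Icc (0 : ℝ) 1
    · rw [indicator_of_mem h, indicator_of_mem h, h4 h, Pi.smul_apply]
    · rw [indicator_of_notMem h, indicator_of_notMem h, smul_zero]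
  eq_zero f h := by
    rw [truncUnit_Icc] at h
    have h1 := hX.eq_zero _ h
    refine AEEqFun.ext ?_
    have h2 : (extendZero f : ℝ → ℝ) =ᵐ[volume.restrict (Ici 0)] 0 := by
      rw [h1]
      exact AEEqFun.coeFn_zero
    filter_upwards [coeFn_extendZero_restrict f,
      ae_restrict_of_ae_restrict_of_subset (fun t ht => ht.1) h2,
      AEEqFun.coeFn_zero (μ := volume.restrict (Icc (0 : ℝ) 1)) (β := ℝ)] with t h3 h4 h5
    rw [← h3, h4, h5]
  ideal f g h := by
    rw [truncUnit_Icc, truncUnit_Icc]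
    refine hX.ideal _ _ ?_
    filter_upwards [coeFn_extendZero f, coeFn_extendZero g, ae_Ici_of_ae_Icc h] with t h1 h2 h3
    rw [h1, h2]
    by_cases h : t ∈ Icc (0 : ℝ) 1
    · rw [indicator_of_mem h, indicator_of_mem h]
      exact h3 h
    · rw [indicator_of_notMem h, indicator_of_notMem h]

theorem IsSolid.ces_truncUnit_embeds {X : ExtNorm (Ici 0)} (hX : X.IsSolid) :
    (X.ces.truncUnit (Icc 0 1)).Embeds ((X.truncUnit (Icc 0 1)).ces.inter (L1 (Icc 0 1))) := by
  -- The half-line leaves room to the right of `1`: the interval `[1,2]` gives an `L¹` bound for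
  -- functions supported on all of `[0,1]`.
  obtain ⟨M, hM, h⟩ := hX.exists_L1_le_ces (l := 1) (b := 2) measurableSet_Ici
    Ioc_zero_subset_Ici one_pos one_lt_two (fun t ht => zero_le_one.trans ht.1)
  refine ⟨max 1 M, lt_max_of_lt_left one_pos, fun f hf => ?_⟩
  rw [Mem, truncUnit_Icc] at hf
  obtain ⟨hd, he⟩ := ces_lt_top hf
  have h1 := h _ (suppIn_extendZero f) hf
  rw [L1_extendZero] at h1
  rw [truncUnit_Icc]
  refine max_le ?_ (h1.trans (by gcongr; exact le_max_right _ _))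
  rw [ces_eq (cesaroDefined_of_extendZero hd), truncUnit_Icc]
  calc X (extendZero (cesaro |f|)) ≤ X (cesaro |extendZero f|) := by
        refine hX.ideal _ _ ?_
        filter_upwards [coeFn_cesaro_extendZero hd, coeFn_extendZero (cesaro |f|),
          coeFn_tailInv 1] with x h2 h3 h4
        rw [h2, h3]
        by_cases hx : x ∈ Icc (0 : ℝ) 1
        · rw [h4, indicator_of_notMem (notMem_Ioi.2 hx.2), mul_zero, add_zero]
        · rw [indicator_of_notMem hx, abs_zero]
          exact abs_nonneg _
    _ = ENNReal.ofReal 1 * X.ces (extendZero f) := by rw [he, ENNReal.ofReal_one, one_mul]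
    _ ≤ _ := by gcongr; exact le_max_left _ _

/-- Finiteness of `‖f‖₁` is used twice: it makes `C|f|` defined on the half-line, and it is the
coefficient of the tail `x⁻¹ χ_(1,∞)`. -/
theorem IsBanachFunctionSpace.inter_embeds {X : ExtNorm (Ici 0)} (hX : X.IsBanachFunctionSpace)
    (ht : X (tailInv 1) < ∞) :
    ((X.truncUnit (Icc 0 1)).ces.inter (L1 (Icc 0 1))).Embeds (X.ces.truncUnit (Icc 0 1)) := by
  refine ⟨1 + (X (tailInv 1)).toReal, by positivity, fun f hf => ?_⟩
  obtain ⟨hf1, hf2⟩ := max_lt_iff.1 hf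
  have hd := cesaroDefined_extendZero hf2
  set c := (L1 (Icc 0 1) f).toReal with hc
  have hc0 : 0 ≤ c := ENNReal.toReal_nonneg
  have he : X.ces (extendZero f) = X (cesaro |extendZero f|) := ces_eq hd
  obtain ⟨-, he2⟩ := ces_lt_top hf1
  rw [truncUnit_Icc] at he2
  rw [truncUnit_Icc, he]
  calc X (cesaro |extendZero f|) ≤ X (extendZero (cesaro |f|)) + X (c • tailInv 1) := by
        refine hX.le_add ?_
        filter_upwards [coeFn_cesaro_extendZero hd, AEEqFun.coeFn_smul c (tailInv 1)] with x h1 h2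
        rw [h1, h2, Pi.smul_apply, smul_eq_mul]
    _ = (X.truncUnit (Icc 0 1)).ces f + L1 (Icc 0 1) f * X (tailInv 1) := by
        rw [he2, hX.smul_eq, Real.enorm_eq_ofReal hc0, hc, ENNReal.ofReal_toReal hf2.ne]
    _ ≤ (X.truncUnit (Icc 0 1)).ces.inter (L1 (Icc 0 1)) f +
          (X.truncUnit (Icc 0 1)).ces.inter (L1 (Icc 0 1)) f * X (tailInv 1) :=
        add_le_add (le_max_left _ _) (mul_le_mul_left (le_max_right _ _) _)
    _ = _ := by
        rw [ENNReal.ofReal_add zero_le_one ENNReal.toReal_nonneg, ENNReal.ofReal_one,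
          ENNReal.ofReal_toReal ht.ne, add_mul, one_mul, mul_comm (X (tailInv 1))]

theorem IsBanachFunctionSpace.ces_truncUnit_sameSpace {X : ExtNorm (Ici 0)}
    (hX : X.IsBanachFunctionSpace) (ht : X (tailInv 1) < ∞) {l : ℝ} (hl : 0 < l) (hl1 : l < 1) :
    (X.ces.truncUnit (Icc 0 l)).SameSpace ((X.truncUnit (Icc 0 1)).ces.trunc (Icc 0 l)) := by
  constructor
  · obtain ⟨M, hM, h⟩ := hX.isSolid.ces_truncUnit_embeds
    refine ⟨M, hM, fun f hf => ?_⟩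
    obtain ⟨hs, he⟩ := truncUnit_lt_top hf
    rw [he, trunc, if_pos hs, ← truncUnit_Icc X.ces]
    refine (le_max_left _ _).trans (h f ?_)
    rw [Mem, truncUnit_Icc, ← he]
    exact hf
  · obtain ⟨M, hM, h⟩ := hX.inter_embeds ht
    obtain ⟨N, hN, h'⟩ := hX.isSolid.truncUnit.exists_L1_le_ces measurableSet_Icc
      Ioc_zero_subset_Icc hl hl1 (Icc_subset_Icc_left hl.le)
    refine ⟨M * max 1 N, mul_pos hM (lt_max_of_lt_left one_pos), fun f hf => ?_⟩
    obtain ⟨hs, he⟩ := trunc_lt_top hf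
    have hf' : (X.truncUnit (Icc 0 1)).ces f < ∞ := he ▸ hf
    have h1 : (X.truncUnit (Icc 0 1)).ces.inter (L1 (Icc 0 1)) f ≤
        ENNReal.ofReal (max 1 N) * (X.truncUnit (Icc 0 1)).ces f := by
      refine max_le ?_ ((h' f hs hf').trans (by gcongr; exact le_max_right _ _))
      calc _ = ENNReal.ofReal 1 * (X.truncUnit (Icc 0 1)).ces f := by
            rw [ENNReal.ofReal_one, one_mul]
        _ ≤ _ := by gcongr; exact le_max_left _ _
    have h2 := h f (h1.trans_lt (ENNReal.mul_lt_top ENNReal.ofReal_lt_top hf'))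
    rw [truncUnit_Icc] at h2
    rw [he, ExtNorm.truncUnit, if_pos hs, ENNReal.ofReal_mul hM.le, mul_assoc]
    exact h2.trans (by gcongr)

end ExtNorm

/-! ### Weighted `L^∞` spaces -/

namespace ExtNorm

/-- The weighted space of all `f` for which `w f` is essentially bounded. -/
def weightedLinf (I : Set ℝ) (w : ℝ → ℝ) : ExtNorm I :=
  fun f => eLpNorm (fun t => w t * f t) ∞ (volume.restrict I)

variable {I : Set ℝ} {w : ℝ → ℝ}

theorem weightedLinf_le_iff {c : ℝ≥0∞} {f : L0 I} :
    weightedLinf I w f ≤ c ↔ ∀ᵐ t ∂(volume.restrict I), ‖w t * f t‖ₑ ≤ c := by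
  rw [weightedLinf, eLpNorm_exponent_top]
  exact ⟨fun h => (ae_le_eLpNormEssSup (f := fun t => w t * f t)).mono fun t ht => ht.trans h,
    eLpNormEssSup_le_of_ae_enorm_bound⟩

theorem weightedLinf_inv_le_one (hw : Measurable w) :
    weightedLinf I w (AEEqFun.mk (fun t => (w t)⁻¹)
      hw.inv.aestronglyMeasurable) ≤ 1 := by
  rw [weightedLinf_le_iff]
  filter_upwards [AEEqFun.coeFn_mk (μ := volume.restrict I) (fun t => (w t)⁻¹)
    hw.inv.aestronglyMeasurable] with t ht
  rw [ht]
  by_cases h : w t = 0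
  · simp [h]
  · rw [mul_inv_cancel₀ h, enorm_one]

/-- Multiplication by `w` is an isometry onto `L^∞`, from which completeness is transferred; `1/w`
is a weak unit. -/
theorem isBanachFunctionSpace_weightedLinf (hw : Measurable w)
    (hpos : ∀ᵐ t ∂(volume.restrict I), 0 < w t) :
    (weightedLinf I w).IsBanachFunctionSpace := by
  have hm : ∀ f : L0 I, AEStronglyMeasurable (fun t => w t * f t) (volume.restrict I) :=
    fun f => hw.aestronglyMeasurable.mul f.aestronglyMeasurable
  have hsub : ∀ f g : L0 I, weightedLinf I w (f - g) =
      eLpNorm ((fun t => w t * f t) - fun t => w t * g t) ∞ (volume.restrict I) := by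
    intro f g
    refine eLpNorm_congr_ae ?_
    filter_upwards [AEEqFun.coeFn_sub f g] with t ht
    simp only [ht, Pi.sub_apply, mul_sub]
  refine ⟨fun f g => ?_, fun c f => ?_, fun f hf => ?_, fun f g h => ?_, fun f hf hc => ?_, ?_⟩
  · refine le_trans (le_of_eq ?_) (eLpNorm_add_le (hm f) (hm g) le_top)
    refine eLpNorm_congr_ae ?_
    filter_upwards [AEEqFun.coeFn_add f g] with t ht
    simp only [ht, Pi.add_apply, mul_add]
  · rw [weightedLinf, weightedLinf, ← eLpNorm_const_smul]
    refine eLpNorm_congr_ae ?_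
    filter_upwards [AEEqFun.coeFn_smul c f] with t ht
    simp only [ht, Pi.smul_apply, smul_eq_mul]
    ring
  · have h1 := (eLpNorm_eq_zero_iff (hm f) ENNReal.top_ne_zero).1 hf
    refine AEEqFun.ext ?_
    filter_upwards [h1, hpos, AEEqFun.coeFn_zero (μ := volume.restrict I) (β := ℝ)]
      with t h2 h3 h4
    rw [h4]
    exact (mul_eq_zero.1 h2).resolve_left h3.ne'
  · refine eLpNorm_mono_ae ?_
    filter_upwards [h] with t ht
    rw [norm_mul, norm_mul]
    exact mul_le_mul_of_nonneg_left ht (norm_nonneg _)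
  · have hL : ∀ n, MemLp (fun t => w t * f n t) ∞ (volume.restrict I) := fun n => ⟨hm _, hf n⟩
    have hcau : CauchySeq fun n => (hL n).toLp := by
      rw [EMetric.cauchySeq_iff]
      intro ε hε
      obtain ⟨N, hN⟩ := hc ε hε
      refine ⟨N, fun m hm' n hn => ?_⟩
      rw [Lp.edist_toLp_toLp, ← hsub]
      exact hN m hm' n hn
    obtain ⟨h, hh⟩ := cauchySeq_tendsto_of_complete hcau
    rw [Lp.tendsto_Lp_iff_tendsto_eLpNorm'] at hh
    have hgm : AEStronglyMeasurable (fun t => (w t)⁻¹ * h t) (volume.restrict I) :=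
      hw.inv.aestronglyMeasurable.mul (Lp.aestronglyMeasurable h)
    have hg : (fun t => w t * AEEqFun.mk _ hgm t) =ᵐ[volume.restrict I] h := by
      filter_upwards [AEEqFun.coeFn_mk _ hgm, hpos] with t h1 h2
      rw [h1, mul_inv_cancel_left₀ h2.ne']
    refine ⟨AEEqFun.mk _ hgm, ?_, hh.congr fun n => ?_⟩
    · rw [Mem, weightedLinf, eLpNorm_congr_ae hg]
      exact Lp.eLpNorm_lt_top h
    · rw [hsub]
      refine eLpNorm_congr_ae ?_
      filter_upwards [hg, (hL n).coeFn_toLp] with t h1 h2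
      simp only [Pi.sub_apply, h1, h2]
  · refine ⟨_, (weightedLinf_inv_le_one hw).trans_lt ENNReal.one_lt_top, ?_⟩
    filter_upwards [AEEqFun.coeFn_mk (μ := volume.restrict I) (fun t => (w t)⁻¹)
      hw.inv.aestronglyMeasurable, hpos] with t h1 h2
    rw [h1]
    exact inv_pos.2 h2

/-- For `t ≤ x`, monotonicity gives `|f(t)| ≤ c/w(t) ≤ c/w(x)`; averaging over `(0,x]` keeps the
bound, so the constant is `1`. -/
theorem cesaroBounded_weightedLinf (hIm : MeasurableSet I) (hI : ∀ x ∈ I, Ioc 0 x ⊆ I)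
    (hI0 : I ⊆ Ici 0) (hpos : ∀ᵐ t ∂(volume.restrict I), 0 < w t) (hanti : Antitone w) :
    (weightedLinf I w).CesaroBounded := by
  refine ⟨1, one_pos, fun f hf => ?_⟩
  set c := (weightedLinf I w f).toReal with hc
  have hcX : ENNReal.ofReal c = weightedLinf I w f := ENNReal.ofReal_toReal hf.ne
  have hfc : ∀ᵐ t ∂(volume.restrict I), |w t * f t| ≤ c := by
    filter_upwards [weightedLinf_le_iff.1 (le_refl (weightedLinf I w f))] with t ht
    rw [← hcX, Real.enorm_eq_ofReal_abs] at ht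
    exact (ENNReal.ofReal_le_ofReal_iff ENNReal.toReal_nonneg).1 ht
  have hbd : ∀ x ∈ I, 0 < w x → ∀ᵐ t ∂(volume.restrict (Ioc 0 x)), ‖f t‖ ≤ c / w x := by
    intro x hx hwx
    filter_upwards [ae_restrict_of_ae_restrict_of_subset (hI x hx) hfc,
      ae_restrict_mem measurableSet_Ioc] with t h1 h2
    rw [le_div_iff₀ hwx, mul_comm]
    refine le_trans (mul_le_mul_of_nonneg_right (hanti h2.2) (norm_nonneg _)) ?_
    rwa [abs_mul, abs_of_pos (hwx.trans_le (hanti h2.2))] at h1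
  constructor
  · filter_upwards [hpos, ae_restrict_mem hIm] with x h1 h2
    exact Measure.integrableOn_of_bounded (by simp) f.stronglyMeasurable.aestronglyMeasurable
      (hbd x h2 h1)
  · rw [ENNReal.ofReal_one, one_mul, weightedLinf_le_iff]
    filter_upwards [hpos, ae_restrict_mem hIm, AEEqFun.coeFn_mk (μ := volume.restrict I) _
      (stronglyMeasurable_cesaro f).aestronglyMeasurable] with x h1 h2 h3
    rw [cesaro, h3, ← hcX, Real.enorm_eq_ofReal_abs]
    refine ENNReal.ofReal_le_ofReal ?_
    have hx0 : 0 ≤ x := hI0 h2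
    have h4 := norm_setIntegral_le_of_norm_le_const_ae (by simp) (hbd x h2 h1)
    rw [Real.norm_eq_abs, measureReal_def, Real.volume_Ioc, sub_zero,
      ENNReal.toReal_ofReal hx0] at h4
    rw [abs_mul, abs_mul, abs_of_pos h1, abs_of_nonneg (inv_nonneg.2 hx0)]
    rcases hx0.eq_or_lt with rfl | hx0
    · simp [hc]
    · calc w x * (x⁻¹ * |∫ t in Ioc 0 x, f t|) ≤ w x * (x⁻¹ * (c / w x * x)) := by gcongr
        _ = c := by field_simp

theorem weightedLinf_not_embeds (hIm : MeasurableSet I) (hw : Measurable w)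
    (hpos : ∀ᵐ t ∂(volume.restrict I), 0 < w t) (hC : (weightedLinf I w).CesaroBounded)
    (hint : ¬ IntegrableOn (fun t => (w t)⁻¹) I) :
    ¬ ((weightedLinf I w).ces.trunc I).Embeds ((L1 I).trunc I) := by
  rintro ⟨M, -, hM⟩
  obtain ⟨K, -, hK⟩ := hC
  set f : L0 I := AEEqFun.mk (fun t => (w t)⁻¹) hw.inv.aestronglyMeasurable with hf
  have hfe : (f : ℝ → ℝ) =ᵐ[volume.restrict I] fun t => (w t)⁻¹ := AEEqFun.coeFn_mk _ _
  have hmem : (weightedLinf I w).Mem |f| := by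
    refine lt_of_le_of_lt ?_ ((weightedLinf_inv_le_one (I := I) hw).trans_lt ENNReal.one_lt_top)
    refine (isBanachFunctionSpace_weightedLinf hw hpos).ideal _ _ ?_
    filter_upwards [AEEqFun.coeFn_abs f] with t ht
    rw [ht, abs_abs]
  have hs : SuppIn f I := by
    filter_upwards [ae_restrict_mem hIm] with t ht _ using ht
  obtain ⟨hd, hle⟩ := hK _ hmem
  have hces : (weightedLinf I w).ces.trunc I f < ∞ := by
    rw [trunc, if_pos hs, ces_eq hd]
    exact hle.trans_lt (ENNReal.mul_lt_top ENNReal.ofReal_lt_top hmem)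
  have h1 := (hM f hces).trans_lt (ENNReal.mul_lt_top ENNReal.ofReal_lt_top hces)
  rw [trunc, if_pos hs] at h1
  refine hint (Integrable.congr (f := f) ⟨f.aestronglyMeasurable, h1⟩ hfe)

end ExtNorm

/-! ### Spaces for which the embedding into `L¹` fails -/

theorem not_integrableOn_inv_one_sub : ¬ IntegrableOn (fun t : ℝ => (1 - t)⁻¹) (Icc 0 1) := by
  intro h
  rw [integrableOn_Icc_iff_integrableOn_Ioc,
    ← intervalIntegrable_iff_integrableOn_Ioc_of_le zero_le_one] at h
  have h1 : IntervalIntegrable (fun t : ℝ => (t - 1)⁻¹) volume 0 1 := by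
    refine h.neg.congr_ae (ae_of_all _ fun t => ?_)
    simp only [Pi.neg_apply]
    rw [← inv_neg, neg_sub]
  -- Integrability of `(t-1)⁻¹` would require the singularity `1` to lie outside the closed
  -- interval.
  rw [intervalIntegrable_sub_inv_iff] at h1
  simp at h1

theorem exists_Icc_ces_not_embeds_L1 :
    ∃ X : ExtNorm (Icc 0 1), X.IsBanachFunctionSpace ∧ (X.CesaroBounded ∨ X.IsSymmetric) ∧
      ¬ (X.ces.trunc (Icc 0 1)).Embeds ((L1 (Icc 0 1)).trunc (Icc 0 1)) := by
  have hw : Measurable fun t : ℝ => 1 - t := measurable_const.sub measurable_id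
  have hpos : ∀ᵐ t ∂(volume.restrict (Icc (0 : ℝ) 1)), 0 < 1 - t := by
    have h0 : ∀ᵐ t : ℝ, t ≠ 1 := by simp [ae_iff]
    filter_upwards [ae_restrict_mem measurableSet_Icc, ae_restrict_of_ae h0] with t h1 h2
    exact sub_pos.2 (lt_of_le_of_ne h1.2 h2)
  have hC := ExtNorm.cesaroBounded_weightedLinf measurableSet_Icc Ioc_zero_subset_Icc
    (fun t ht => ht.1) hpos (fun a b h => sub_le_sub_left h 1)
  exact ⟨_, ExtNorm.isBanachFunctionSpace_weightedLinf hw hpos, Or.inl hC,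
    ExtNorm.weightedLinf_not_embeds measurableSet_Icc hw hpos hC not_integrableOn_inv_one_sub⟩

theorem exists_Ici_ces_not_embeds_L1 :
    ∃ X : ExtNorm (Ici 0), X.IsBanachFunctionSpace ∧
      (X.CesaroBounded ∨ (X.IsSymmetric ∧ X.ces.Nontrivial)) ∧
      ¬ (X.ces.trunc (Ici 0)).Embeds ((L1 (Ici 0)).trunc (Ici 0)) := by
  have hw : Measurable fun _ : ℝ => (1 : ℝ) := measurable_const
  have hpos : ∀ᵐ t ∂(volume.restrict (Ici (0 : ℝ))), (0 : ℝ) < (fun _ => 1) t :=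
    ae_of_all _ fun _ => one_pos
  have hC := ExtNorm.cesaroBounded_weightedLinf measurableSet_Ici Ioc_zero_subset_Ici
    subset_rfl hpos antitone_const
  refine ⟨_, ExtNorm.isBanachFunctionSpace_weightedLinf hw hpos, Or.inl hC,
    ExtNorm.weightedLinf_not_embeds measurableSet_Ici hw hpos hC ?_⟩
  rw [integrableOn_const_iff]
  simp

/-! ### Absolutely convergent series of positive functions -/

theorem coeFn_sum_range {I : Set ℝ} (u : ℕ → L0 I) :
    ∀ᵐ t ∂(volume.restrict I), ∀ N : ℕ,
      (∑ n ∈ Finset.range N, u n : L0 I) t = ∑ n ∈ Finset.range N, u n t := by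
  filter_upwards [AEEqFun.coeFn_zero (μ := volume.restrict I) (β := ℝ),
    ae_all_iff.2 fun N => AEEqFun.coeFn_add (∑ n ∈ Finset.range N, u n) (u N)] with t h0 h N
  induction N with
  | zero => simpa using h0
  | succ N ih => rw [Finset.sum_range_succ, Finset.sum_range_succ, h N, Pi.add_apply, ih]

namespace ExtNorm

theorem IsSolid.zero {I : Set ℝ} {X : ExtNorm I} (hX : X.IsSolid) : X 0 = 0 := by
  simpa using hX.smul_eq 0 0

theorem IsSolid.sub_comm {I : Set ℝ} {X : ExtNorm I} (hX : X.IsSolid) (f g : L0 I) :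
    X (f - g) = X (g - f) := by
  have h := hX.smul_eq (-1) (g - f)
  rwa [neg_one_smul, neg_sub, enorm_neg, enorm_one, one_mul] at h

theorem IsBanachFunctionSpace.sum_le {I : Set ℝ} {X : ExtNorm I} (hX : X.IsBanachFunctionSpace)
    (u : ℕ → L0 I) (N : ℕ) : X (∑ n ∈ Finset.range N, u n) ≤ ∑ n ∈ Finset.range N, X (u n) := by
  induction N with
  | zero => simp [hX.isSolid.zero]
  | succ N ih =>
    rw [Finset.sum_range_succ, Finset.sum_range_succ]
    exact (hX.add_le _ _).trans (by gcongr)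

/-- The partial sums are Cauchy, and their norm limit is an upper bound for each of them. -/
theorem IsBanachFunctionSpace.exists_sum_le {I : Set ℝ} {X : ExtNorm I}
    (hX : X.IsBanachFunctionSpace) (u : ℕ → L0 I)
    (hu : ∀ n, ∀ᵐ t ∂(volume.restrict I), 0 ≤ u n t) (hs : ∑' n, X (u n) ≠ ∞) :
    ∃ g : L0 I, X g < ∞ ∧
      ∀ᵐ t ∂(volume.restrict I), ∀ N : ℕ, ∑ n ∈ Finset.range N, u n t ≤ g t := by
  set S : ℕ → L0 I := fun N => ∑ n ∈ Finset.range N, u n with hS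
  have hle : ∀ N M, N ≤ M → X (S M - S N) ≤ ∑' k, X (u (k + N)) := by
    intro N M hNM
    obtain ⟨k, rfl⟩ := Nat.exists_eq_add_of_le hNM
    have h1 : S (N + k) - S N = ∑ n ∈ Finset.range k, u (n + N) := by
      simp only [hS, Finset.sum_range_add, add_sub_cancel_left, add_comm]
    rw [h1]
    exact (hX.sum_le _ _).trans (ENNReal.sum_le_tsum _)
  have htail := ENNReal.tendsto_sum_nat_add (fun n => X (u n)) hs
  have hmem : ∀ N, X.Mem (S N) := fun N =>
    ((hX.sum_le u N).trans (ENNReal.sum_le_tsum _)).trans_lt hs.lt_top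
  obtain ⟨g, hg, hlim⟩ := hX.complete S hmem (by
    intro ε hε
    obtain ⟨N, hN⟩ := ((tendsto_order.1 htail).2 ε hε).exists_forall_of_atTop
    refine ⟨N, fun m hm n hn => ?_⟩
    rcases le_total n m with h | h
    · exact (hle n m h).trans_lt (hN n hn)
    · rw [hX.isSolid.sub_comm]
      exact (hle m n h).trans_lt (hN m hm))
  refine ⟨g, hg, ae_all_iff.2 fun N => ?_⟩
  -- For `M ≥ N` positivity of the terms gives `(S_N - g)⁺ ≤ |S_M - g|`, whose norm tends to zero.
  -- No almost everywhere convergent subsequence is needed.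
  have hz : X ((S N - g) ⊔ 0) = 0 := by
    refine le_antisymm (ge_of_tendsto hlim ?_) zero_le
    filter_upwards [eventually_ge_atTop N] with M hM
    refine hX.ideal _ _ ?_
    filter_upwards [AEEqFun.coeFn_sup (S N - g) 0, AEEqFun.coeFn_sub (S N) g,
      AEEqFun.coeFn_sub (S M) g, AEEqFun.coeFn_zero (μ := volume.restrict I) (β := ℝ),
      coeFn_sum_range u, ae_all_iff.2 hu] with t h1 h2 h3 h4 h5 h6
    have h7 : S N t ≤ S M t := by
      rw [h5, h5]
      exact Finset.sum_le_sum_of_subset_of_nonneg (Finset.range_mono hM) fun n _ _ => h6 n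
    rw [h1, h2, h3, h4, Pi.sub_apply, Pi.sub_apply, Pi.zero_apply, abs_of_nonneg le_sup_right]
    exact sup_le ((sub_le_sub_right h7 _).trans (le_abs_self _)) (abs_nonneg _)
  have hz' := hX.eq_zero _ hz
  filter_upwards [AEEqFun.coeFn_sup (S N - g) 0, AEEqFun.coeFn_sub (S N) g,
    AEEqFun.coeFn_zero (μ := volume.restrict I) (β := ℝ), coeFn_sum_range u] with t h1 h2 h3 h4
  rw [hz', h2, h3, Pi.sub_apply, Pi.zero_apply] at h1
  rw [← h4]
  exact sub_nonpos.1 (le_sup_left.trans h1.symm.le)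

end ExtNorm

/-! ### Dilations of indicator functions -/

theorem coeFn_dilation {τ : ℝ} (hτ : 0 < τ) {f : L0 (Ici 0)} {g : ℝ → ℝ}
    (h : (f : ℝ → ℝ) =ᵐ[volume.restrict (Ici 0)] g) :
    (dilation τ f : ℝ → ℝ) =ᵐ[volume.restrict (Ici 0)] fun x => g (x / τ) := by
  have h1 : ∀ᵐ y : ℝ, y ∈ Ici (0 : ℝ) → f y = g y := (ae_restrict_iff' measurableSet_Ici).1 h
  have h2 := (Measure.quasiMeasurePreserving_smul (volume : Measure ℝ)
    (inv_ne_zero hτ.ne')).ae h1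
  have h3 : (dilation τ f : ℝ → ℝ) =ᵐ[volume.restrict (Ici 0)] fun x => f (x / τ) :=
    AEEqFun.coeFn_mk _ _
  filter_upwards [h3, ae_restrict_of_ae h2, ae_restrict_mem measurableSet_Ici] with x h4 h5 hx
  rw [smul_eq_mul, inv_mul_eq_div] at h5
  rw [h4, h5 (div_nonneg hx hτ.le)]

namespace ExtNorm

/-- The dilation `σ_τ` maps `χ_[0,a]` to `χ_[0,τa]`; the operator norm is tested on `χ_[0,a]` scaled
to norm one. -/
theorem IsSolid.indL0_le_opNorm_mul {X : ExtNorm (Ici 0)} (hX : X.IsSolid) {τ : ℝ} (hτ : 0 < τ)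
    {a : ℝ} (ha : 0 < a)
    (hfin : X (indL0 (Ici 0) (measurableSet_Icc (a := (0 : ℝ)) (b := a))) < ∞) :
    X (indL0 (Ici 0) (measurableSet_Icc (a := (0 : ℝ)) (b := τ * a))) ≤
      X.opNorm (dilation τ) * X (indL0 (Ici 0) (measurableSet_Icc (a := (0 : ℝ)) (b := a))) := by
  set e := indL0 (Ici 0) (measurableSet_Icc (a := (0 : ℝ)) (b := a)) with he
  have he0 : X e ≠ 0 := fun h => indL0_ne_zero measurableSet_Icc (by
    have hsub : Icc 0 a ⊆ Ici 0 := fun t ht => ht.1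
    rw [Measure.restrict_apply measurableSet_Icc, inter_eq_left.2 hsub, Real.volume_Icc]
    simpa using ha) (hX.eq_zero _ h)
  set k := (X e).toReal with hk
  have hk0 : 0 < k := ENNReal.toReal_pos he0 hfin.ne
  have hkX : ENNReal.ofReal k = X e := ENNReal.ofReal_toReal hfin.ne
  have hunit : X (k⁻¹ • e) ≤ 1 := by
    rw [hX.smul_eq, Real.enorm_eq_ofReal (inv_nonneg.2 hk0.le), ← hkX,
      ← ENNReal.ofReal_mul (inv_nonneg.2 hk0.le), inv_mul_cancel₀ hk0.ne', ENNReal.ofReal_one]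
  have h1 : ENNReal.ofReal k⁻¹ *
      X (indL0 (Ici 0) (measurableSet_Icc (a := (0 : ℝ)) (b := τ * a))) ≤
        X.opNorm (dilation τ) := by
    refine le_trans (hX.mul_le (inv_nonneg.2 hk0.le) ?_)
      (le_iSup₂ (f := fun (f : L0 (Ici 0)) (_ : X f ≤ 1) => X (dilation τ f)) (k⁻¹ • e) hunit)
    have h2 : ((k⁻¹ • e : L0 (Ici 0)) : ℝ → ℝ) =ᵐ[volume.restrict (Ici 0)]
        fun t => k⁻¹ * (Icc 0 a).indicator (fun _ => (1 : ℝ)) t := by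
      filter_upwards [AEEqFun.coeFn_smul k⁻¹ e, coeFn_indL0 (Ici 0) measurableSet_Icc]
        with t h3 h4
      rw [h3, Pi.smul_apply, smul_eq_mul, he, h4]
    filter_upwards [coeFn_dilation hτ h2, coeFn_indL0 (Ici 0) measurableSet_Icc] with t h3 h4
    rw [h3, h4, abs_mul, abs_of_nonneg (inv_nonneg.2 hk0.le)]
    refine le_of_eq ?_
    congr 2
    have h5 : t ∈ Icc 0 (τ * a) ↔ t / τ ∈ Icc 0 a := by
      rw [mem_Icc, mem_Icc, div_le_iff₀ hτ, le_div_iff₀ hτ, zero_mul, mul_comm]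
    by_cases h6 : t / τ ∈ Icc 0 a
    · rw [indicator_of_mem h6, indicator_of_mem (h5.2 h6)]
    · rw [indicator_of_notMem h6, indicator_of_notMem fun h => h6 (h5.1 h)]
  rw [ENNReal.ofReal_inv_of_pos hk0, hkX] at h1
  rw [mul_comm (X.opNorm _)]
  exact (ENNReal.inv_mul_le_iff he0 hfin.ne).1 h1

theorem IsUpperBoydIndex.exists_opNorm_dilation_lt_one {X : ExtNorm (Ici 0)} {q : ℝ≥0∞}
    (h : X.IsUpperBoydIndex q) (hq : q < ∞) :
    ∃ τ : ℝ, 0 < τ ∧ τ < 1 ∧ X.opNorm (dilation τ) < 1 := by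
  have h1 := (tendsto_order.1 h).2 ∞ hq
  have h2 : ∀ᶠ τ : ℝ in 𝓝[>] 0, τ ∈ Ioo (0 : ℝ) 1 := Ioo_mem_nhdsGT one_pos
  obtain ⟨τ, h3, h4⟩ := (h1.and h2).exists
  refine ⟨τ, h4.1, h4.2, ?_⟩
  have hlog : 0 < -Real.log τ := neg_pos.2 (Real.log_neg h4.1 h4.2)
  -- Otherwise the denominator is truncated to `0` and the quotient is `∞`. The convention `log 0 =
  -- 0` makes this exclude an infinite operator norm too, since its `toReal` is `0`.
  have h5 : Real.log (X.opNorm (dilation τ)).toReal < 0 := by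
    by_contra hcon
    rw [ENNReal.ofReal_of_nonpos (by linarith : -Real.log (X.opNorm (dilation τ)).toReal ≤ 0),
      ENNReal.div_zero (by simpa using hlog)] at h3
    exact lt_irrefl _ h3
  have hfin : X.opNorm (dilation τ) ≠ ∞ := by
    intro htop
    rw [htop, ENNReal.toReal_top, Real.log_zero] at h5
    exact lt_irrefl _ h5
  have h6 : (X.opNorm (dilation τ)).toReal < 1 := by
    by_contra hcon
    exact absurd (Real.log_nonneg (not_lt.1 hcon)) (not_le.2 h5)
  rw [← ENNReal.ofReal_toReal hfin]
  exact ENNReal.ofReal_lt_one.2 h6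

/-- The interval `[1-τⁿ,1]` has the length of `[0,τⁿ]`, which is `[0,1]` dilated `n` times, so the
`n`-th norm is at most `‖σ_τ‖ⁿ ‖χ_[0,1]‖`. -/
theorem IsSymmetric.tsum_indL0_ne_top {X : ExtNorm (Ici 0)} (hX : X.IsSymmetric) {τ : ℝ}
    (hτ : 0 < τ) (hτ1 : τ < 1) (hr : X.opNorm (dilation τ) < 1) :
    ∑' n : ℕ, X (indL0 (Ici 0) (measurableSet_Icc (a := 1 - τ ^ n) (b := 1))) ≠ ∞ := by
  have hS := hX.toIsBanachFunctionSpace.isSolid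
  set r := X.opNorm (dilation τ) with hrdef
  set C := X (indL0 (Ici 0) (measurableSet_Icc (a := (0 : ℝ)) (b := 1))) with hC
  have hpow : ∀ n : ℕ,
      X (indL0 (Ici 0) (measurableSet_Icc (a := (0 : ℝ)) (b := τ ^ n))) ≤ r ^ n * C := by
    intro n
    induction n with
    | zero =>
      simp only [pow_zero, one_mul]
      exact le_refl C
    | succ n ih =>
      simp only [pow_succ' τ n]
      refine (hS.indL0_le_opNorm_mul hτ (pow_pos hτ n) (hX.indL0_Icc_lt_top _)).trans ?_
      rw [pow_succ' r, mul_assoc]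
      exact mul_le_mul_right ih _
  have hle : ∀ n : ℕ,
      X (indL0 (Ici 0) (measurableSet_Icc (a := 1 - τ ^ n) (b := 1))) ≤ r ^ n * C := by
    intro n
    refine le_trans (le_of_eq (hX.eq_of_equimeasurable _ _
      (equimeasurable_indL0 measurableSet_Icc measurableSet_Icc ?_))) (hpow n)
    have h1 : Icc (1 - τ ^ n) 1 ⊆ Ici 0 := fun t ht =>
      (sub_nonneg.2 (pow_le_one₀ hτ.le hτ1.le)).trans ht.1
    have h2 : Icc 0 (τ ^ n) ⊆ Ici 0 := fun t ht => ht.1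
    rw [Measure.restrict_apply measurableSet_Icc, Measure.restrict_apply measurableSet_Icc,
      inter_eq_left.2 h1, inter_eq_left.2 h2, Real.volume_Icc, Real.volume_Icc]
    congr 1
    ring
  refine ((ENNReal.tsum_le_tsum hle).trans_lt ?_).ne
  rw [ENNReal.tsum_mul_right, ENNReal.tsum_geometric]
  exact ENNReal.mul_lt_top (ENNReal.inv_lt_top.2 (tsub_pos_of_lt hr)) (hX.indL0_Icc_lt_top 1)

end ExtNorm

/-! ### A function with non-integrable singularity at `1` -/

/-- The class of the function `t / (1 - t)` on `[0,1]`. -/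
def singularAtOne : L0 (Icc 0 1) :=
  AEEqFun.mk (fun t : ℝ => t / (1 - t))
    (measurable_id.div (measurable_const.sub measurable_id)).aestronglyMeasurable

theorem coeFn_singularAtOne :
    (singularAtOne : ℝ → ℝ) =ᵐ[volume.restrict (Icc 0 1)] fun t => t / (1 - t) :=
  AEEqFun.coeFn_mk _ _

theorem L1_singularAtOne : L1 (Icc 0 1) singularAtOne = ∞ := by
  by_contra h
  have h1 : IntegrableOn (fun t : ℝ => t / (1 - t)) (Icc 0 1) :=
    Integrable.congr (f := singularAtOne)
      ⟨singularAtOne.aestronglyMeasurable, lt_top_iff_ne_top.2 h⟩ coeFn_singularAtOne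
  have h2 : IntegrableOn (fun _ : ℝ => (1 : ℝ)) (Icc 0 1) := by
    rw [integrableOn_const_iff]
    simp
  refine not_integrableOn_inv_one_sub ((h1.add h2).congr ?_)
  have h0 : ∀ᵐ t : ℝ, t ≠ 1 := by simp [ae_iff]
  filter_upwards [ae_restrict_of_ae h0] with t ht
  have ht' : 1 - t ≠ 0 := sub_ne_zero.2 ht.symm
  simp only [Pi.add_apply]
  field_simp
  ring

theorem integrableOn_inv_one_sub {x : ℝ} (hx1 : x < 1) :
    IntegrableOn (fun t : ℝ => (1 - t)⁻¹) (Ioc 0 x) := by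
  refine (ContinuousOn.integrableOn_Icc ?_).mono_set Ioc_subset_Icc_self
  exact ContinuousOn.inv₀ (by fun_prop) fun t ht => by linarith [ht.2]

theorem integral_inv_one_sub {x : ℝ} (hx : 0 ≤ x) (hx1 : x < 1) :
    ∫ t in Ioc 0 x, (1 - t)⁻¹ = -Real.log (1 - x) := by
  rw [← intervalIntegral.integral_of_le hx,
    intervalIntegral.integral_comp_sub_left (fun t => t⁻¹) 1, sub_zero,
    integral_inv_of_pos (by linarith) one_pos, one_div, Real.log_inv]

theorem abs_singularAtOne_le {x : ℝ} (hx : 0 ≤ x) (hx1 : x < 1) :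
    ∀ᵐ t ∂(volume.restrict (Ioc 0 x)), |singularAtOne t| ≤ x * (1 - t)⁻¹ := by
  filter_upwards [ae_restrict_of_ae_restrict_of_subset (Ioc_zero_subset_Icc x ⟨hx, hx1.le⟩)
    coeFn_singularAtOne, ae_restrict_mem measurableSet_Ioc] with t h1 h2
  have h3 : 0 < 1 - t := by linarith [h2.2]
  rw [h1, abs_of_nonneg (div_nonneg h2.1.le h3.le), div_eq_mul_inv]
  exact mul_le_mul_of_nonneg_right h2.2 (inv_pos.2 h3).le

theorem integrableOn_singularAtOne {x : ℝ} (hx : 0 ≤ x) (hx1 : x < 1) :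
    IntegrableOn singularAtOne (Ioc 0 x) :=
  Integrable.mono' ((integrableOn_inv_one_sub hx1).const_mul x)
    singularAtOne.stronglyMeasurable.aestronglyMeasurable (abs_singularAtOne_le hx hx1)

theorem cesaroDefined_singularAtOne : CesaroDefined |singularAtOne| := by
  rw [cesaroDefined_abs_iff measurableSet_Icc Ioc_zero_subset_Icc]
  have h0 : ∀ᵐ t : ℝ, t ≠ 1 := by simp [ae_iff]
  filter_upwards [ae_restrict_of_ae h0, ae_restrict_mem measurableSet_Icc] with x h1 h2
  exact integrableOn_singularAtOne h2.1 (lt_of_le_of_ne h2.2 h1)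

/-- Under the integral the numerator `t` is at most `x`, which cancels the factor `1/x` of the mean
and leaves `∫_0^x dt/(1-t)`. -/
theorem cesaro_singularAtOne_le :
    ∀ᵐ x ∂(volume.restrict (Icc (0 : ℝ) 1)), |cesaro |singularAtOne| x| ≤ -Real.log (1 - x) := by
  have h0 : ∀ᵐ t : ℝ, t ≠ 1 := by simp [ae_iff]
  filter_upwards [ae_restrict_of_ae h0, ae_restrict_mem measurableSet_Icc,
    coeFn_cesaro_abs measurableSet_Icc Ioc_zero_subset_Icc singularAtOne] with x h1 h2 h3
  have hx1 : x < 1 := lt_of_le_of_ne h2.2 h1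
  have h4 : ∫ t in Ioc 0 x, |singularAtOne t| ≤ x * -Real.log (1 - x) := by
    rw [← integral_inv_one_sub h2.1 hx1, ← integral_const_mul]
    exact integral_mono_ae (integrableOn_singularAtOne h2.1 hx1).abs
      ((integrableOn_inv_one_sub hx1).const_mul x) (abs_singularAtOne_le h2.1 hx1)
  rw [h3, abs_of_nonneg (mul_nonneg (inv_nonneg.2 h2.1) (integral_nonneg fun _ => abs_nonneg _))]
  rcases h2.1.eq_or_lt with rfl | hx0
  · simp
  · rwa [inv_mul_le_iff₀ hx0]

namespace ExtNorm

theorem IsSymmetric.ces_truncUnit_singularAtOne_lt_top {X : ExtNorm (Ici 0)} (hX : X.IsSymmetric)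
    {τ : ℝ} (hτ : 0 < τ) (hτ1 : τ < 1) (hr : X.opNorm (dilation τ) < 1) :
    (X.truncUnit (Icc 0 1)).ces singularAtOne < ∞ := by
  have hu : ∀ n : ℕ, ∀ᵐ t ∂(volume.restrict (Ici (0 : ℝ))), indL0 (Ici 0)
      (measurableSet_Icc (a := 1 - τ ^ n) (b := 1)) t =
        (Icc (1 - τ ^ n) 1).indicator (fun _ => (1 : ℝ)) t :=
    fun n => coeFn_indL0 (Ici 0) measurableSet_Icc
  obtain ⟨g, hg, hsum⟩ := hX.exists_sum_le
    (fun n => indL0 (Ici 0) (measurableSet_Icc (a := 1 - τ ^ n) (b := 1)))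
    (fun n => (hu n).mono fun t ht => ht ▸ indicator_nonneg (fun _ _ => zero_le_one) t)
    (hX.tsum_indL0_ne_top hτ hτ1 hr)
  have hlog : 0 < -Real.log τ := neg_pos.2 (Real.log_neg hτ hτ1)
  rw [ces_eq cesaroDefined_singularAtOne, truncUnit_Icc]
  refine hX.toIsBanachFunctionSpace.isSolid.lt_top_of_mul_le (inv_pos.2 hlog) ?_ hg
  have h0 : ∀ᵐ t : ℝ, t ≠ 1 := by simp [ae_iff]
  filter_upwards [ae_restrict_of_ae h0, coeFn_extendZero (cesaro |singularAtOne|),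
    ae_Ici_of_ae_Icc cesaro_singularAtOne_le, ae_all_iff.2 hu, hsum] with x h1 h2 h3 h4 h5
  rw [h2]
  by_cases hx : x ∈ Icc (0 : ℝ) 1
  · have hx1 : x < 1 := lt_of_le_of_ne hx.2 h1
    -- With `τ^(n+1) < 1-x ≤ τ^n`, the point `x` lies in the intervals of index `0, …, n`, so `g x ≥
    -- n+1`, while `-log(1-x) ≤ (n+1)(-log τ)`.
    obtain ⟨n, hn1, hn2⟩ := exists_nat_pow_near_of_lt_one (sub_pos.2 hx1)
      (by linarith [hx.1] : 1 - x ≤ 1) hτ hτ1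
    rw [indicator_of_mem hx, inv_mul_le_iff₀ hlog]
    have h6 : ∀ k ∈ Finset.range (n + 1),
        indL0 (Ici 0) (measurableSet_Icc (a := 1 - τ ^ k) (b := 1)) x = 1 := by
      intro k hk
      have h7 : τ ^ n ≤ τ ^ k :=
        pow_le_pow_of_le_one hτ.le hτ1.le (Nat.lt_succ_iff.1 (Finset.mem_range.1 hk))
      rw [h4 k, indicator_of_mem]
      exact ⟨by linarith, hx.2⟩
    have h8 : ((n + 1 : ℕ) : ℝ) ≤ g x := by
      have h9 := h5 (n + 1)
      rw [Finset.sum_congr rfl h6] at h9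
      simpa using h9
    have h10 : -Real.log (1 - x) ≤ -Real.log τ * ((n + 1 : ℕ) : ℝ) := by
      have h11 := Real.log_le_log (pow_pos hτ (n + 1)) hn1.le
      rw [Real.log_pow] at h11
      linarith
    exact (h3 hx).trans (h10.trans (mul_le_mul_of_nonneg_left (h8.trans (le_abs_self _)) hlog.le))
  · rw [indicator_of_notMem hx, abs_zero, mul_zero]
    exact abs_nonneg _

theorem IsSolid.ces_truncUnit_singularAtOne_eq_top {X : ExtNorm (Ici 0)} (hX : X.IsSolid) :
    X.ces.truncUnit (Icc 0 1) singularAtOne = ∞ := by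
  by_contra h
  obtain ⟨M, -, hM⟩ := hX.ces_truncUnit_embeds
  have h1 := (hM singularAtOne (lt_top_iff_ne_top.2 h)).trans_lt
    (ENNReal.mul_lt_top ENNReal.ofReal_lt_top (lt_top_iff_ne_top.2 h))
  exact (max_lt_iff.1 h1).2.ne L1_singularAtOne

theorem IsSymmetric.not_subspace_ces_truncUnit {X : ExtNorm (Ici 0)} (hX : X.IsSymmetric)
    {q : ℝ≥0∞} (h : X.IsUpperBoydIndex q) (hq : q < ∞) :
    ¬ (X.truncUnit (Icc 0 1)).ces.Subspace (X.ces.truncUnit (Icc 0 1)) := by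
  intro hsub
  obtain ⟨τ, hτ, hτ1, hr⟩ := h.exists_opNorm_dilation_lt_one hq
  exact (hsub _ (hX.ces_truncUnit_singularAtOne_lt_top hτ hτ1 hr)).ne
    hX.toIsBanachFunctionSpace.isSolid.ces_truncUnit_singularAtOne_eq_top

theorem Embeds.subspace {I : Set ℝ} {X Y : ExtNorm I} (h : X.Embeds Y) : X.Subspace Y := by
  obtain ⟨M, -, hM⟩ := h
  exact fun f hf => (hM f hf).trans_lt (ENNReal.mul_lt_top ENNReal.ofReal_lt_top hf)

end ExtNorm

end

theorem lemma5p1 :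
    -- the embedding on `[0,1]`
    (∀ X : ExtNorm (Icc 0 1), X.IsBanachFunctionSpace → (X.CesaroBounded ∨ X.IsSymmetric) →
      ∀ l : ℝ, 0 < l → l < 1 →
        (X.ces.trunc (Icc 0 l)).Embeds ((L1 (Icc 0 1)).trunc (Icc 0 l))) ∧
    -- the embedding on `[0,∞)`
    (∀ X : ExtNorm (Ici 0), X.IsBanachFunctionSpace →
      (X.CesaroBounded ∨ (X.IsSymmetric ∧ X.ces.Nontrivial)) →
      ∀ l : ℝ, 0 < l →
        (X.ces.trunc (Icc 0 l)).Embeds ((L1 (Ici 0)).trunc (Icc 0 l))) ∧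
    -- it fails in general for `l = 1` on `[0,1]`
    (∃ X : ExtNorm (Icc 0 1), X.IsBanachFunctionSpace ∧ (X.CesaroBounded ∨ X.IsSymmetric) ∧
      ¬ (X.ces.trunc (Icc 0 1)).Embeds ((L1 (Icc 0 1)).trunc (Icc 0 1))) ∧
    -- it fails in general for `l = ∞` on `[0,∞)`
    (∃ X : ExtNorm (Ici 0), X.IsBanachFunctionSpace ∧
      (X.CesaroBounded ∨ (X.IsSymmetric ∧ X.ces.Nontrivial)) ∧
      ¬ (X.ces.trunc (Ici 0)).Embeds ((L1 (Ici 0)).trunc (Ici 0))) ∧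
    -- the two equalities
    (∀ X : ExtNorm (Ici 0), X.IsBanachFunctionSpace →
      (X.CesaroBounded ∨ (X.IsSymmetric ∧ X.ces.Nontrivial)) →
      (X.ces.truncUnit (Icc 0 1)).SameSpace ((X.truncUnit (Icc 0 1)).ces.inter (L1 (Icc 0 1))) ∧
      ∀ l : ℝ, 0 < l → l < 1 →
        (X.ces.truncUnit (Icc 0 l)).SameSpace ((X.truncUnit (Icc 0 1)).ces.trunc (Icc 0 l))) ∧
    -- truncation and the Cesàro construction do not commute
    (∀ X : ExtNorm (Ici 0), X.IsSymmetric → ∀ q : ℝ≥0∞, X.IsUpperBoydIndex q → q < ∞ →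
      ¬ (X.truncUnit (Icc 0 1)).ces.SameSpace (X.ces.truncUnit (Icc 0 1)) ∧
      ¬ (X.truncUnit (Icc 0 1)).ces.Subspace (X.ces.truncUnit (Icc 0 1))) := by
  exact
    ⟨fun X hX _ l hl hl1 => hX.isSolid.ces_trunc_embeds_L1 measurableSet_Icc Ioc_zero_subset_Icc hl
        hl1 (Icc_subset_Icc_left hl.le),
      fun X hX _ l hl => hX.isSolid.ces_trunc_embeds_L1 measurableSet_Ici Ioc_zero_subset_Ici hl
        (lt_add_one l) (fun _ ht => hl.le.trans ht.1),
      exists_Icc_ces_not_embeds_L1, exists_Ici_ces_not_embeds_L1,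
      fun X hX h => ⟨⟨hX.isSolid.ces_truncUnit_embeds,
          hX.inter_embeds (ExtNorm.tailInv_one_lt_top hX h)⟩,
        fun l hl hl1 => hX.ces_truncUnit_sameSpace (ExtNorm.tailInv_one_lt_top hX h) hl hl1⟩,
      fun X hX q hq hq1 =>
        ⟨fun h => hX.not_subspace_ces_truncUnit hq hq1 h.1.subspace,
          hX.not_subspace_ces_truncUnit hq hq1⟩⟩
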